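/- Let $n\ge 2$, let $\{k,l,m_1,\dots,m_{n-2}\}$ be the standard basis of $\mathbb R^n$ with dual basis $\omega^1,\dots,\omega^n$, and let $\eta=\omega^1\otimes\omega^2+\omega^2\otimes\omega^1+\omega^3\otimes\omega^3+\cdots+\omega^n\otimes\omega^n$. Let $GN\subset GL(n,\mathbb R)$ be the group of all invertible $f$ with $f(k)\in\mathbb R k$, $\eta(f(w),f(w'))=\eta(w,w')$ for all $w,w'\in\{k\}^\perp$, and $\eta(f(k),f(z))=\eta(k,z)$ for all $z\in\mathbb R^n$. A $GN$-structure $P\to M$ on an $n$-manifold $M$ is a smooth reduction of the frame bundle to $GN$; it determines the distributions $\lambda_x=u(\mathbb R k)$ and $\Lambda_x=u(\{k\}^\perp)$, for any frame $u:\mathbb R^n\to T_xM$ in $P$ at $x$. A diffeomorphism is an automorphism of $P$ if its derivative maps $P$ into itself, and a vector field is an infinitesimal automorphism of $P$ if its flow (its local flow, if it is only locally defined) preserves $P$ in this sense. $P$ is a Kundt structure if $\Lambda$ is integrable (closed under brackets of local sections) and about each point there is a local nowhere-vanishing vector field belonging to $\lambda$ which is an infinitesimal automorphism of $P$. Let $N$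 be an $n$-dimensional nilpotent Lie group, i.e. a real Lie group whose Lie algebra $\mathfrak n$ is nilpotent, and let $P\to N$ be a left-invariant Kundt structure (all left translations are automorphisms of $P$). Let $(\mathfrak a,\mathfrak b,(\cdot,\cdot),\beta)$ be the corresponding quadruple on $\mathfrak n=T_eN$: $\mathfrak a=\lambda_e$ is a line, $\mathfrak b=\Lambda_e\supset\mathfrak a$ a hyperplane, $(\cdot,\cdot)$ is the positive definite inner product on $\mathfrak b/\mathfrak a$ with $([u(w)],[u(w')])=\eta(w,w')$ for all frames $u$ in $P$ at $e$ and all $w,w'\in\{k\}^\perp$, and $\beta:\mathfrak a\otimes\mathfrak n/\mathfrak b\to\mathbb R$ is the non-zero functional with $\beta(u(k)\otimes[u(l)])=1$ for all such $u$. Then $$[\mathfrak a,\mathfrak b]\subset\mathfrak a\qquad\text{and}\qquad[\mathfrak a,\mathfrak n]\subset\mathfrak b.$$ Moreover, every left-invariant vector field $X$ on $N$ with $X_e\in\mathfrak a$ is an infinitesimal automorphism of $P$: it is complete and every diffeomorphism $\phi_t$ of its flow is an automorphism of $P$. -/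

import Mathlib

open scoped Manifold ContDiff

noncomputable section

/-- A real smooth Lie group satisfies the smoothness assumption under which Mathlib provides
the Lie algebra structure on its tangent space at the identity. -/
instance lieGroupMinSmoothness {E : Type*} [NormedAddCommGroup E] [NormedSpace ℝ E]
    {H : Type*} [TopologicalSpace H] (I : ModelWithCorners ℝ E H)
    (G : Type*) [TopologicalSpace G] [ChartedSpace H G] [Group G] [LieGroup I ∞ G] :
    LieGroup I (minSmoothness ℝ 3) G := by
  rw [minSmoothness_of_isRCLikeNormedField]
  infer_instance

/-! ### The structure group -/

/-- The Minkowski form `ω¹ ⊗ ω² + ω² ⊗ ω¹ + ω³ ⊗ ω³ + ⋯ + ωⁿ ⊗ ωⁿ` on `ℝⁿ`, `n = m + 2`. -/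
def minkowski {m : ℕ} (v w : Fin (m + 2) → ℝ) : ℝ :=
  v 0 * w 1 + v 1 * w 0 + ∑ i : Fin m, v i.succ.succ * w i.succ.succ

/-- The first standard basis vector, denoted `k`; it is null for `minkowski`. -/
def nullK (m : ℕ) : Fin (m + 2) → ℝ := Pi.single 0 1

/-- The second standard basis vector, denoted `l`; it is null for `minkowski`. -/
def nullL (m : ℕ) : Fin (m + 2) → ℝ := Pi.single 1 1

theorem minkowski_nullK {m : ℕ} (w : Fin (m + 2) → ℝ) : minkowski (nullK m) w = w 1 := by
  have h : ∀ i : Fin m, (i.succ.succ : Fin (m + 2)) ≠ 0 := fun i => Fin.succ_ne_zero _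
  simp [minkowski, nullK, h]

theorem minkowski_smul_left {m : ℕ} (c : ℝ) (v w : Fin (m + 2) → ℝ) :
    minkowski (c • v) w = c * minkowski v w := by
  simp only [minkowski, Pi.smul_apply, smul_eq_mul, mul_add, Finset.mul_sum, mul_assoc]

/-- The group `GN ⊆ GL(n, ℝ)` of invertible `f` with `f k ∈ ℝ k`, with
`η (f w, f w') = η (w, w')` for `w, w'` in the orthogonal complement of `k`, and with
`η (f k, f z) = η (k, z)` for all `z`. -/
def groupGN (m : ℕ) : Subgroup ((Fin (m + 2) → ℝ) ≃ₗ[ℝ] (Fin (m + 2) → ℝ)) where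
  carrier := {f | (∃ c : ℝ, f (nullK m) = c • nullK m) ∧
    (∀ w w' : Fin (m + 2) → ℝ, minkowski (nullK m) w = 0 → minkowski (nullK m) w' = 0 →
      minkowski (f w) (f w') = minkowski w w') ∧
    ∀ z : Fin (m + 2) → ℝ, minkowski (f (nullK m)) (f z) = minkowski (nullK m) z}
  one_mem' := ⟨⟨1, by simp⟩, fun _ _ _ _ => rfl, fun _ => rfl⟩
  mul_mem' := by
    rintro f g ⟨⟨c, hc⟩, hf2, hf3⟩ ⟨⟨d, hd⟩, hg2, hg3⟩
    have key : ∀ z, d * minkowski (nullK m) (g z) = minkowski (nullK m) z := fun z => by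
      rw [← minkowski_smul_left, ← hd, hg3]
    have hd0 : d ≠ 0 := by
      rintro rfl
      have := key (nullL m)
      simp [minkowski_nullK, nullL] at this
    have perp : ∀ z, minkowski (nullK m) z = 0 → minkowski (nullK m) (g z) = 0 := fun z hz => by
      have := key z
      rw [hz] at this
      exact (mul_eq_zero.mp this).resolve_left hd0
    refine ⟨⟨d * c, ?_⟩, fun w w' hw hw' => ?_, fun z => ?_⟩
    · rw [LinearEquiv.mul_apply, hd, map_smul, hc, smul_smul]
    · rw [LinearEquiv.mul_apply, LinearEquiv.mul_apply, hf2 _ _ (perp _ hw) (perp _ hw'),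
        hg2 _ _ hw hw']
    · rw [LinearEquiv.mul_apply, LinearEquiv.mul_apply, hd, map_smul, minkowski_smul_left, hf3,
        key]
  inv_mem' := by
    rintro f ⟨⟨c, hc⟩, hf2, hf3⟩
    have hff : ∀ z, f (f⁻¹ z) = z := fun z => f.apply_symm_apply z
    have key : ∀ z, c * minkowski (nullK m) z = minkowski (nullK m) (f⁻¹ z) := fun z => by
      rw [← minkowski_smul_left, ← hc, ← hf3, hff]
    have hc0 : c ≠ 0 := by
      rintro rfl
      have := key (f (nullL m))
      rw [show f⁻¹ (f (nullL m)) = nullL m from f.symm_apply_apply _] at this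
      simp [minkowski_nullK, nullL] at this
    have hk : f⁻¹ (nullK m) = c⁻¹ • nullK m := by
      apply f.injective
      rw [hff, map_smul, hc, smul_smul, inv_mul_cancel₀ hc0, one_smul]
    refine ⟨⟨c⁻¹, hk⟩, fun w w' hw hw' => ?_, fun z => ?_⟩
    · rw [← hf2 (f⁻¹ w) (f⁻¹ w') (by rw [← key, hw, mul_zero]) (by rw [← key, hw', mul_zero]),
        hff, hff]
    · rw [hk, minkowski_smul_left, ← key, inv_mul_cancel_left₀ hc0]

/-! ### `G`-structures and their automorphisms -/

section GStructures

variable {E : Type*} [NormedAddCommGroup E] [NormedSpace ℝ E]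
  {H : Type*} [TopologicalSpace H] {I : ModelWithCorners ℝ E H}
  {M : Type*} [TopologicalSpace M] [ChartedSpace H M] [IsManifold I ∞ M]

variable (I) in
/-- The vector field `X` is smooth on the set `U`. -/
def SmoothVectorFieldOn (X : (x : M) → TangentSpace I x) (U : Set M) : Prop :=
  ContMDiffOn I I.tangent ∞ (fun x => (⟨x, X x⟩ : TangentBundle I M)) U

variable (I M) in
/-- A `G`-structure on the manifold `M`, where `G` is a group of linear automorphisms of `ℝⁿ`:
a reduction of the frame bundle to `G`. A frame at `x` is a linear isomorphism `ℝⁿ → T_x M`.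
The set of distinguished frames at each point is an orbit of the (free) right action of `G` on
frames, and the distinguished frames admit smooth local sections. -/
structure GStructure {n : ℕ} (G : Subgroup ((Fin n → ℝ) ≃ₗ[ℝ] (Fin n → ℝ))) where
  frames : (x : M) → Set ((Fin n → ℝ) →ₗ[ℝ] TangentSpace I x)
  bijective : ∀ x, ∀ u ∈ frames x, Function.Bijective u
  nonempty : ∀ x, (frames x).Nonempty
  mem_iff : ∀ x, ∀ u ∈ frames x, ∀ v : (Fin n → ℝ) →ₗ[ℝ] TangentSpace I x,
    v ∈ frames x ↔ ∃ g ∈ G, v = u ∘ₗ g.toLinearMap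
  exists_section : ∀ x, ∃ U : Set M, IsOpen U ∧ x ∈ U ∧
    ∃ σ : (y : M) → ((Fin n → ℝ) →ₗ[ℝ] TangentSpace I y),
      (∀ y ∈ U, σ y ∈ frames y) ∧
      ∀ i : Fin n, SmoothVectorFieldOn I (fun y => σ y (Pi.single i 1)) U

/-- The derivative of `f` at `x` sends distinguished frames at `x` to distinguished frames
at `f x`. -/
def GStructure.PreservedAt {n : ℕ} {G : Subgroup ((Fin n → ℝ) ≃ₗ[ℝ] (Fin n → ℝ))}
    (P : GStructure I M G) (f : M → M) (x : M) : Prop :=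
  ∀ u ∈ P.frames x, (mfderiv I I f x).toLinearMap ∘ₗ u ∈ P.frames (f x)

/-- A diffeomorphism `f` is an automorphism of `P` if the map it induces on the frame bundle
sends `P` into itself. -/
def GStructure.IsAutomorphism {n : ℕ} {G : Subgroup ((Fin n → ℝ) ≃ₗ[ℝ] (Fin n → ℝ))}
    (P : GStructure I M G) (f : M ≃ₘ⟮I, I⟯ M) : Prop :=
  ∀ x, P.PreservedAt f x

variable (I) in
/-- `φ` is a smooth flow of the vector field `X`, defined for times in `J` and starting
points in `V`. -/
structure IsFlowOn (X : (x : M) → TangentSpace I x) (J : Set ℝ) (V : Set M)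
    (φ : ℝ → M → M) : Prop where
  smooth : ContMDiffOn (𝓘(ℝ, ℝ).prod I) I ∞ (fun p : ℝ × M => φ p.1 p.2) (J ×ˢ V)
  zero : ∀ x ∈ V, φ 0 x = x
  integral : ∀ x ∈ V, IsMIntegralCurveOn (I := I) (fun t => φ t x) X J

/-- The vector field `X` on `M` is a (complete) infinitesimal automorphism of `P`: it is smooth
and has a global flow `φ`, and each `φ t` is an automorphism of `P`. -/
def GStructure.IsInfinitesimalAutomorphism {n : ℕ}
    {G : Subgroup ((Fin n → ℝ) ≃ₗ[ℝ] (Fin n → ℝ))}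
    (P : GStructure I M G) (X : (x : M) → TangentSpace I x) : Prop :=
  SmoothVectorFieldOn I X Set.univ ∧
  ∃ φ : ℝ → M ≃ₘ⟮I, I⟯ M,
    IsFlowOn I X Set.univ Set.univ (fun t => φ t) ∧ ∀ t, P.IsAutomorphism (φ t)

/-- The vector field `X`, defined on the open set `U`, is a local infinitesimal automorphism
of `P`: it is smooth on `U` and its local flow, which need not exist for all times,
preserves `P`. -/
def GStructure.IsInfinitesimalAutomorphismOn {n : ℕ}
    {G : Subgroup ((Fin n → ℝ) ≃ₗ[ℝ] (Fin n → ℝ))}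
    (P : GStructure I M G) (X : (x : M) → TangentSpace I x) (U : Set M) : Prop :=
  SmoothVectorFieldOn I X U ∧
  ∀ p ∈ U, ∃ V : Set M, IsOpen V ∧ p ∈ V ∧ V ⊆ U ∧ ∃ ε > 0, ∃ φ : ℝ → M → M,
    IsFlowOn I X (Set.Ioo (-ε) ε) V φ ∧
    ∀ t ∈ Set.Ioo (-ε) ε, ∀ x ∈ V, φ t x ∈ U ∧ P.PreservedAt (φ t) x

/-! ### `GN`-structures and Kundt structures -/

variable (I M) in
/-- A `GN`-structure on a manifold of dimension `m + 2`. -/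
abbrev GNStructure (m : ℕ) := GStructure I M (groupGN m)

/-- The line `λ_x = u (ℝ k)`, for any distinguished frame `u` at `x`. -/
def GStructure.nullLine {m : ℕ} (P : GNStructure I M m) (x : M) :
    Submodule ℝ (TangentSpace I x) :=
  ⨆ u ∈ P.frames x, (Submodule.span ℝ {nullK m}).map u

/-- The hyperplane `Λ_x = u ({k}^⊥)`, for any distinguished frame `u` at `x`. -/
def GStructure.nullHyperplane {m : ℕ} (P : GNStructure I M m) (x : M) :
    Submodule ℝ (TangentSpace I x) :=
  ⨆ u ∈ P.frames x, (Submodule.span ℝ {w | minkowski (nullK m) w = 0}).map u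

variable (I) in
/-- Integrability of a distribution `D`: the bracket of two local smooth vector fields
belonging to `D` belongs to `D`. -/
def IsIntegrableDistribution (D : (x : M) → Submodule ℝ (TangentSpace I x)) : Prop :=
  ∀ U : Set M, IsOpen U → ∀ X Y : (x : M) → TangentSpace I x,
    SmoothVectorFieldOn I X U → SmoothVectorFieldOn I Y U →
    (∀ x ∈ U, X x ∈ D x) → (∀ x ∈ U, Y x ∈ D x) →
    ∀ x ∈ U, VectorField.mlieBracket I X Y x ∈ D x

/-- A `GN`-structure is Kundt if `Λ` is integrable and about each point there is a local
nowhere-vanishing vector field belonging to `λ` which is an infinitesimal automorphism. -/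
structure GStructure.IsKundt {m : ℕ} (P : GNStructure I M m) : Prop where
  integrable : IsIntegrableDistribution I P.nullHyperplane
  exists_field : ∀ p : M, ∃ U : Set M, IsOpen U ∧ p ∈ U ∧ ∃ X : (x : M) → TangentSpace I x,
    (∀ x ∈ U, X x ∈ P.nullLine x ∧ X x ≠ 0) ∧ P.IsInfinitesimalAutomorphismOn X U

end GStructures

/-! ### Left-invariant structures on Lie groups -/

section LieGroups

open scoped TensorProduct

variable {E : Type*} [NormedAddCommGroup E] [NormedSpace ℝ E]
  {H : Type*} [TopologicalSpace H] {I : ModelWithCorners ℝ E H}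
  {N : Type*} [TopologicalSpace N] [ChartedSpace H N] [Group N] [LieGroup I ∞ N]

/-- A `G`-structure on a Lie group is left-invariant if all left translations are
automorphisms. -/
def GStructure.IsLeftInvariant {n : ℕ} {G : Subgroup ((Fin n → ℝ) ≃ₗ[ℝ] (Fin n → ℝ))}
    (P : GStructure I N G) : Prop :=
  ∀ g x : N, P.PreservedAt (fun y => g * y) x

/-- A quadruple `(𝔞, 𝔟, (·,·), β)` on a vector space `𝔫`: a line `𝔞` inside a hyperplane `𝔟`, a
positive definite inner product on `𝔟 / 𝔞` and a non-zero functional on `𝔞 ⊗ 𝔫 / 𝔟`. -/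
structure NullQuadruple (L : Type*) [AddCommGroup L] [Module ℝ L] where
  a : Submodule ℝ L
  b : Submodule ℝ L
  a_le_b : a ≤ b
  finrank_a : Module.finrank ℝ a = 1
  finrank_quotient_b : Module.finrank ℝ (L ⧸ b) = 1
  form : LinearMap.BilinForm ℝ (b ⧸ a.submoduleOf b)
  form_symm : ∀ v w, form v w = form w v
  form_pos : ∀ v, v ≠ 0 → 0 < form v v
  β : a ⊗[ℝ] (L ⧸ b) →ₗ[ℝ] ℝ
  β_ne_zero : β ≠ 0

/-- The quadruple on the Lie algebra corresponding to a `GN`-structure `P`: one has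
`𝔞 = λ_e` and `𝔟 = Λ_e`, and for each distinguished frame `u` at the identity, the inner
product on `𝔟 / 𝔞` corresponds under `u` to the Minkowski form on `{k}^⊥ / ℝ k`, and
`β (u k ⊗ [u l]) = 1`. -/
structure NullQuadruple.CorrespondsTo {m : ℕ} (Q : NullQuadruple (GroupLieAlgebra I N))
    (P : GNStructure I N m) : Prop where
  a_eq : Q.a = P.nullLine 1
  b_eq : Q.b = P.nullHyperplane 1
  form_eq : ∀ u ∈ P.frames 1, ∀ w w' : Fin (m + 2) → ℝ, ∀ (hw : u w ∈ Q.b) (hw' : u w' ∈ Q.b),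
    Q.form (Submodule.Quotient.mk ⟨u w, hw⟩) (Submodule.Quotient.mk ⟨u w', hw'⟩) = minkowski w w'
  β_eq : ∀ u ∈ P.frames 1, ∀ hk : u (nullK m) ∈ Q.a,
    Q.β (⟨u (nullK m), hk⟩ ⊗ₜ[ℝ] Submodule.Quotient.mk (u (nullL m))) = 1

end LieGroups

end

noncomputable section

/-! ### Calculus -/

section Calculus

variable {E F : Type*} [NormedAddCommGroup E] [NormedSpace ℝ E]
  [NormedAddCommGroup F] [NormedSpace ℝ F]

/-! Fix a distinguished frame `u` at the identity, put `A = u k`, and let `D` be `ad A` read through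
`u`. It is nilpotent and `D k = 0`. Everything follows once `D` is zero on the graded pieces of the
flag `ℝ k ⊆ {k}^⊥ ⊆ ℝⁿ`.

Integrability makes `Λ_e` a subalgebra, so `D` preserves `{k}^⊥`; on the line `ℝⁿ / {k}^⊥` it is
then a nilpotent scalar, hence zero. On `{k}^⊥` the Kundt field enters. Near the identity it is `X =
f · A^L`, with `A^L` left-invariant and `f` a function. Its local flow followed by the left
translation back to the identity has differentials in `GN`, and their derivative at time `0` sends
`Z` to `[Z^L, X]_e = f(e) [Z, A] + (Z f) A` (`hasDerivAt_mfderiv_translated_flow`,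
`mlieBracket_eq_of_eventually_eq_smul`). As `GN` preserves the form on `{k}^⊥` and `k` is orthogonal
to `{k}^⊥`, `D` is skew there (`GStructure.minkowski_frameAd_eq_zero`). A nilpotent skew
endomorphism of the Euclidean space `{k}^⊥ / ℝ k` vanishes (`exists_eq_smul_nullK_of_isNilpotent`).

For the last claim, the flow of a left-invariant field in `𝔞` is right multiplication by a
one-parameter subgroup `γ`. Translated back to the identity it becomes a conjugation, whose
differential solves a linear equation with generator a multiple of `D`. Since `D` is zero on the
graded pieces, the solution is trivial on them too, which already puts it in `GN`
(`exists_mem_groupGN_of_hasDerivAt`). Left invariance carries this to every point. -/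

/-- The time derivative of the space derivative of `f` is the space derivative of the time
derivative. -/
theorem hasDerivAt_fderiv_right {f : ℝ × E → F} {t₀ : ℝ} {x₀ : E}
    (hf : ContDiffAt ℝ 2 f (t₀, x₀)) (z : E) :
    HasDerivAt (fun t => fderiv ℝ (fun x => f (t, x)) x₀ z)
      (fderiv ℝ (fun x => deriv (fun t => f (t, x)) t₀) x₀ z) t₀ := by
  have hev : ∀ᶠ p in nhds (t₀, x₀), DifferentiableAt ℝ f p := by
    filter_upwards [hf.eventually (by simp)] with p hp using hp.differentiableAt (by simp)
  have hd : DifferentiableAt ℝ (fderiv ℝ f) (t₀, x₀) :=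
    (hf.fderiv_right (m := 1) (by norm_num)).differentiableAt (by simp)
  have hi : ∀ t x, HasFDerivAt (fun x => ((t, x) : ℝ × E)) (ContinuousLinearMap.inr ℝ ℝ E) x :=
    fun t x => hasFDerivAt_prodMk_right t x
  have hj : ∀ t x, HasDerivAt (fun t => ((t, x) : ℝ × E)) (1, 0) t :=
    fun t x => (hasDerivAt_id t).prodMk (hasDerivAt_const t x)
  -- Both partial derivatives are values of the full derivative, in the directions `(0, z)` and `(1,
  -- 0)`, so the claim becomes symmetry of the second derivative.
  have h1 : (fun t => fderiv ℝ (fun x => f (t, x)) x₀ z) =ᶠ[nhds t₀]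
      fun t => fderiv ℝ f (t, x₀) (0, z) := by
    have hc : ContinuousAt (fun t => ((t, x₀) : ℝ × E)) t₀ := by fun_prop
    filter_upwards [hc.eventually hev] with t ht
    have := (show HasFDerivAt (fun x => f (t, x)) _ x₀ from
      ht.hasFDerivAt.comp x₀ (hi t x₀)).fderiv
    rw [this]
    simp
  have h2 : (fun x => deriv (fun t => f (t, x)) t₀) =ᶠ[nhds x₀]
      fun x => fderiv ℝ f (t₀, x) (1, 0) := by
    have hc : ContinuousAt (fun x => ((t₀, x) : ℝ × E)) x₀ := by fun_prop
    filter_upwards [hc.eventually hev] with x hx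
    exact (hx.hasFDerivAt.comp_hasDerivAt t₀ (hj t₀ x)).deriv
  have h3 : HasDerivAt (fun t => fderiv ℝ f (t, x₀) (0, z))
      (fderiv ℝ (fderiv ℝ f) (t₀, x₀) (1, 0) (0, z)) t₀ := by
    have h : HasDerivAt (fun t => fderiv ℝ f (t, x₀))
        (fderiv ℝ (fderiv ℝ f) (t₀, x₀) (1, 0)) t₀ :=
      HasFDerivAt.comp_hasDerivAt (f := fun t => ((t, x₀) : ℝ × E)) t₀ hd.hasFDerivAt (hj t₀ x₀)
    exact ((ContinuousLinearMap.apply ℝ F ((0, z) : ℝ × E)).hasFDerivAt.comp_hasDerivAt t₀ h)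
  have h4 : HasFDerivAt (fun x => fderiv ℝ f (t₀, x) (1, 0))
      ((ContinuousLinearMap.apply ℝ F ((1, 0) : ℝ × E)).comp
        ((fderiv ℝ (fderiv ℝ f) (t₀, x₀)).comp (ContinuousLinearMap.inr ℝ ℝ E))) x₀ :=
    (ContinuousLinearMap.apply ℝ F ((1, 0) : ℝ × E)).hasFDerivAt.comp x₀
      (HasFDerivAt.comp (f := fun x => ((t₀, x) : ℝ × E)) x₀ hd.hasFDerivAt (hi t₀ x₀))
  refine (h3.congr_of_eventuallyEq h1).congr_deriv ?_
  rw [h2.fderiv_eq, h4.fderiv]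
  have := hf.isSymmSndFDerivAt (by simp)
  simpa using this (1, 0) (0, z)

/-- A solution of an autonomous differential equation is smooth where the right hand side is. -/
theorem contDiffAt_of_eventually_hasDerivAt {y : ℝ → F} {w : F → F} {t₀ : ℝ}
    (hw : ContDiffAt ℝ ∞ w (y t₀)) (hy : ∀ᶠ t in nhds t₀, HasDerivAt y (w (y t)) t) :
    ContDiffAt ℝ ∞ y t₀ := by
  rw [contDiffAt_infty]
  intro n
  induction n with
  | zero =>
    obtain ⟨u, hu, h⟩ := hy.exists_mem
    exact contDiffAt_zero.2 ⟨u, hu, fun t ht => (h t ht).continuousAt.continuousWithinAt⟩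
  | succ n ih =>
    rw [Nat.cast_add, Nat.cast_one, contDiffAt_succ_iff_hasFDerivAt]
    obtain ⟨u, hu, h⟩ := hy.exists_mem
    -- Bootstrapping: if `y` is `C^n`, so is its derivative `w ∘ y`, hence `y` is `C^(n+1)`.
    refine ⟨fun t => ContinuousLinearMap.toSpanSingleton ℝ (w (y t)), ⟨u, hu, fun t ht =>
      (h t ht).hasFDerivAt⟩, ?_⟩
    exact (ContinuousLinearMap.toSpanSingletonCLE (𝕜 := ℝ) (E := F)).contDiff.contDiffAt.comp t₀
      (((hw.of_le (by exact_mod_cast le_top)).comp t₀ ih))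

end Calculus

/-! ### Vector fields in a chart -/

section Charts

variable {E : Type*} [NormedAddCommGroup E] [NormedSpace ℝ E]
  {M : Type*} [TopologicalSpace M] [ChartedSpace E M]

/-- The vector field `V` in the chart at `x₀`. -/
def chartField (x₀ : M) (V : (x : M) → TangentSpace 𝓘(ℝ, E) x) (z : E) : E :=
  VectorField.mpullbackWithin 𝓘(ℝ, E) 𝓘(ℝ, E) (extChartAt 𝓘(ℝ, E) x₀).symm V
    (Set.range 𝓘(ℝ, E)) z

/-- The map `f : M → M` in the charts at `x₀` and `x₁`. -/
def chartMap (x₀ x₁ : M) (f : M → M) (z : E) : E :=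
  extChartAt 𝓘(ℝ, E) x₁ (f ((extChartAt 𝓘(ℝ, E) x₀).symm z))

theorem continuousAt_extChartAt_symm_self (x₀ : M) :
    ContinuousAt (extChartAt 𝓘(ℝ, E) x₀).symm (extChartAt 𝓘(ℝ, E) x₀ x₀) :=
  continuousAt_extChartAt_symm x₀

variable [IsManifold 𝓘(ℝ, E) ∞ M]

theorem chartField_extChartAt {x₀ y : M} (V : (x : M) → TangentSpace 𝓘(ℝ, E) x)
    (hy : y ∈ (extChartAt 𝓘(ℝ, E) x₀).source) :
    chartField x₀ V (extChartAt 𝓘(ℝ, E) x₀ y) =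
      mfderiv 𝓘(ℝ, E) 𝓘(ℝ, E) (extChartAt 𝓘(ℝ, E) x₀) y (V y) := by
  have : IsManifold 𝓘(ℝ, E) 1 M := .of_le (n := ∞) (by norm_num)
  -- The pullback evaluates `V` at the image of `y` under the chart and back, which is `y` only
  -- propositionally; generalizing over `z` avoids rewriting in a dependent type.
  have h : ∀ z, z = y → (mfderivWithin 𝓘(ℝ, E) 𝓘(ℝ, E) (extChartAt 𝓘(ℝ, E) x₀).symm
      (Set.range 𝓘(ℝ, E)) (extChartAt 𝓘(ℝ, E) x₀ y)).inverse (V z) =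
      mfderiv 𝓘(ℝ, E) 𝓘(ℝ, E) (extChartAt 𝓘(ℝ, E) x₀) y (V y) := by
    rintro z rfl
    exact congrArg (fun f : E →L[ℝ] E => f (V z)) <| ContinuousLinearMap.inverse_eq
      (f := (mfderivWithin 𝓘(ℝ, E) 𝓘(ℝ, E) (extChartAt 𝓘(ℝ, E) x₀).symm
        (Set.range 𝓘(ℝ, E)) (extChartAt 𝓘(ℝ, E) x₀ z) : E →L[ℝ] E))
      (g := (mfderiv 𝓘(ℝ, E) 𝓘(ℝ, E) (extChartAt 𝓘(ℝ, E) x₀) z : E →L[ℝ] E))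
      (mfderivWithin_extChartAt_symm_comp_mfderiv_extChartAt' hy)
      (mfderiv_extChartAt_comp_mfderivWithin_extChartAt_symm' hy)
  exact h _ ((extChartAt 𝓘(ℝ, E) x₀).left_inv hy)

theorem chartField_self {x₀ : M} (V : (x : M) → TangentSpace 𝓘(ℝ, E) x) :
    chartField x₀ V (extChartAt 𝓘(ℝ, E) x₀ x₀) = V x₀ := by
  have : IsManifold 𝓘(ℝ, E) 1 M := .of_le (n := ∞) (by norm_num)
  rw [chartField_extChartAt V (mem_extChartAt_source x₀), mfderiv_extChartAt_self]
  rfl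

theorem contDiffAt_chartField [CompleteSpace E] {x₀ : M} {V : (x : M) → TangentSpace 𝓘(ℝ, E) x}
    (hV : ContMDiffAt 𝓘(ℝ, E) 𝓘(ℝ, E).tangent ∞
      (fun x => (⟨x, V x⟩ : TangentBundle 𝓘(ℝ, E) M)) x₀) :
    ContDiffAt ℝ ∞ (chartField x₀ V) (extChartAt 𝓘(ℝ, E) x₀ x₀) := by
  have h := VectorField.contMDiffWithinAt_mpullbackWithin_extChartAt_symm (n := ∞)
    (contMDiffWithinAt_univ.2 hV) uniqueMDiffOn_univ (Set.mem_univ x₀) (by simp)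
  have h2 := (contMDiff_snd_tangentBundle_modelSpace E 𝓘(ℝ, E)).contMDiffAt.comp_contMDiffWithinAt
    _ h
  refine contMDiffAt_iff_contDiffAt.1 (ContMDiffWithinAt.contMDiffAt h2 ?_)
  simpa using extChartAt_target_mem_nhds (I := 𝓘(ℝ, E)) x₀

/-- The preferred chart at `x₀` has identity derivative there, so no pullback remains. This fixes
the sign convention `[V, W] = DW · V - DV · W`. -/
theorem mlieBracket_eq_chartField {x₀ : M}
    (V W : (x : M) → TangentSpace 𝓘(ℝ, E) x) :
    VectorField.mlieBracket 𝓘(ℝ, E) V W x₀ =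
      (fderiv ℝ (chartField x₀ W) (extChartAt 𝓘(ℝ, E) x₀ x₀) (V x₀) -
        fderiv ℝ (chartField x₀ V) (extChartAt 𝓘(ℝ, E) x₀ x₀) (W x₀) : E) := by
  have : IsManifold 𝓘(ℝ, E) 1 M := .of_le (n := ∞) (by norm_num)
  have hid : ∀ (f : E →L[ℝ] E) (w : E), f = ContinuousLinearMap.id ℝ E → f.inverse w = w := by
    rintro _ w rfl
    rw [ContinuousLinearMap.inverse_id]
    rfl
  rw [← VectorField.mlieBracketWithin_univ, VectorField.mlieBracketWithin_apply]
  refine (hid _ _ mfderiv_extChartAt_self).trans ?_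
  have h : ((extChartAt 𝓘(ℝ, E) x₀).symm ⁻¹' Set.univ ∩ Set.range 𝓘(ℝ, E)) = Set.univ := by simp
  change VectorField.lieBracketWithin ℝ (chartField x₀ V) (chartField x₀ W) _ _ = _
  rw [h, VectorField.lieBracketWithin_univ, VectorField.lieBracket, chartField_self,
    chartField_self]

theorem hasDerivAt_extChartAt_comp {x₀ : M} {V : (x : M) → TangentSpace 𝓘(ℝ, E) x}
    {γ : ℝ → M} {t : ℝ} (hγ : HasMFDerivAt 𝓘(ℝ, ℝ) 𝓘(ℝ, E) γ t
      ((1 : ℝ →L[ℝ] ℝ).smulRight (V (γ t)))) (hs : γ t ∈ (extChartAt 𝓘(ℝ, E) x₀).source) :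
    HasDerivAt (fun s => extChartAt 𝓘(ℝ, E) x₀ (γ s))
      (chartField x₀ V (extChartAt 𝓘(ℝ, E) x₀ (γ t))) t := by
  have : IsManifold 𝓘(ℝ, E) 1 M := .of_le (n := ∞) (by norm_num)
  have h := (mdifferentiableAt_extChartAt (I := 𝓘(ℝ, E))
    ((extChartAt_source 𝓘(ℝ, E) x₀) ▸ hs)).hasMFDerivAt.comp t hγ
  rw [hasDerivAt_iff_hasFDerivAt, chartField_extChartAt V hs]
  refine (hasMFDerivAt_iff_hasFDerivAt.1 h).congr_fderiv (ContinuousLinearMap.ext fun a => ?_)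
  exact map_smul (mfderiv 𝓘(ℝ, E) 𝓘(ℝ, E) (extChartAt 𝓘(ℝ, E) x₀) (γ t) : E →L[ℝ] E)
    (show ℝ from a) (show E from V (γ t))

theorem fderiv_chartMap {x₀ x₁ : M} {f : M → M} (hf : MDifferentiableAt 𝓘(ℝ, E) 𝓘(ℝ, E) f x₀)
    (hs : f x₀ ∈ (extChartAt 𝓘(ℝ, E) x₁).source) (z : E) :
    fderiv ℝ (chartMap x₀ x₁ f) (extChartAt 𝓘(ℝ, E) x₀ x₀) z =
      mfderiv 𝓘(ℝ, E) 𝓘(ℝ, E) (extChartAt 𝓘(ℝ, E) x₁) (f x₀)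
        (mfderiv 𝓘(ℝ, E) 𝓘(ℝ, E) f x₀ z) := by
  have : IsManifold 𝓘(ℝ, E) 1 M := .of_le (n := ∞) (by norm_num)
  have h := (mdifferentiableAt_extChartAt (I := 𝓘(ℝ, E))
    ((extChartAt_source 𝓘(ℝ, E) x₁) ▸ hs)).comp x₀ hf
  have h2 := mfderiv_comp x₀ (mdifferentiableAt_extChartAt (I := 𝓘(ℝ, E))
    ((extChartAt_source 𝓘(ℝ, E) x₁) ▸ hs)) hf
  refine Eq.trans ?_ (congrArg (fun g : E →L[ℝ] E => g z) h2)
  rw [h.mfderiv]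
  simp only [modelWithCornersSelf_coe, Set.range_id, fderivWithin_univ]
  rfl

theorem fderiv_chartMap_self {x₀ : M} {f : M → M}
    (hf : MDifferentiableAt 𝓘(ℝ, E) 𝓘(ℝ, E) f x₀) (hx : f x₀ = x₀) (z : E) :
    fderiv ℝ (chartMap x₀ x₀ f) (extChartAt 𝓘(ℝ, E) x₀ x₀) z =
      mfderiv 𝓘(ℝ, E) 𝓘(ℝ, E) f x₀ z := by
  have : IsManifold 𝓘(ℝ, E) 1 M := .of_le (n := ∞) (by norm_num)
  rw [fderiv_chartMap hf (by rw [hx]; exact mem_extChartAt_source x₀)]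
  have h : ∀ y, y = x₀ → ∀ w : E, (mfderiv 𝓘(ℝ, E) 𝓘(ℝ, E) (extChartAt 𝓘(ℝ, E) x₀) y :
      E →L[ℝ] E) w = w := by
    rintro y rfl w
    rw [mfderiv_extChartAt_self]
    rfl
  exact h _ hx _

/-- A jointly smooth family of maps is jointly smooth in charts. -/
theorem contDiffAt_chartMap {x₀ x₁ : M} {φ : ℝ → M → M} {t₀ : ℝ}
    (hφ : ContMDiffAt (𝓘(ℝ, ℝ).prod 𝓘(ℝ, E)) 𝓘(ℝ, E) ∞ (fun p : ℝ × M => φ p.1 p.2) (t₀, x₀))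
    (hs : φ t₀ x₀ ∈ (extChartAt 𝓘(ℝ, E) x₁).source) :
    ContDiffAt ℝ ∞ (fun p : ℝ × E => chartMap x₀ x₁ (φ p.1) p.2)
      (t₀, extChartAt 𝓘(ℝ, E) x₀ x₀) := by
  have h1 : ContMDiffAt 𝓘(ℝ, E) 𝓘(ℝ, E) ∞ (extChartAt 𝓘(ℝ, E) x₁) (φ t₀ x₀) :=
    contMDiffAt_extChartAt' ((extChartAt_source 𝓘(ℝ, E) x₁) ▸ hs)
  have h2 : ContMDiffAt 𝓘(ℝ, E) 𝓘(ℝ, E) ∞ (extChartAt 𝓘(ℝ, E) x₀).symm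
      (extChartAt 𝓘(ℝ, E) x₀ x₀) :=
    (contMDiffOn_extChartAt_symm x₀).contMDiffAt (extChartAt_target_mem_nhds x₀)
  have h3 : ContMDiffAt 𝓘(ℝ, ℝ × E) (𝓘(ℝ, ℝ).prod 𝓘(ℝ, E)) ∞
      (fun p : ℝ × E => (p.1, (extChartAt 𝓘(ℝ, E) x₀).symm p.2))
      (t₀, extChartAt 𝓘(ℝ, E) x₀ x₀) :=
    (contDiff_fst.contMDiff.contMDiffAt).prodMk
      (ContMDiffAt.comp (t₀, extChartAt 𝓘(ℝ, E) x₀ x₀) h2 contDiff_snd.contMDiff.contMDiffAt)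
  have hx : (extChartAt 𝓘(ℝ, E) x₀).symm (extChartAt 𝓘(ℝ, E) x₀ x₀) = x₀ :=
    extChartAt_to_inv x₀
  have h4 := (ContMDiffAt.comp_of_eq (y := φ t₀ x₀) h1 hφ rfl)
  exact contMDiffAt_iff_contDiffAt.1 (ContMDiffAt.comp_of_eq
    (f := fun p : ℝ × E => (p.1, (extChartAt 𝓘(ℝ, E) x₀).symm p.2)) h4 h3 (by rw [hx]))

end Charts

/-! ### Flows on Lie groups -/

section LieGroupFlows

open Bundle

variable {E : Type*} [NormedAddCommGroup E] [NormedSpace ℝ E]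
  {N : Type*} [TopologicalSpace N] [ChartedSpace E N] [Group N] [LieGroup 𝓘(ℝ, E) ∞ N]

/-- Left-invariant vector fields are smooth. -/
theorem contMDiff_infty_mulInvariantVectorField (v : GroupLieAlgebra 𝓘(ℝ, E) N) :
    ContMDiff 𝓘(ℝ, E) 𝓘(ℝ, E).tangent ∞
      (fun g : N => (⟨g, mulInvariantVectorField v g⟩ : TangentBundle 𝓘(ℝ, E) N)) := by
  -- The field at `g` is the differential of multiplication `N × N → N` at `(g, 1)` applied to `(0,
  -- v)`, a composite of smooth maps in `g`.
  let fg : N → TangentBundle 𝓘(ℝ, E) N := fun g => TotalSpace.mk' E g 0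
  have sfg : ContMDiff 𝓘(ℝ, E) 𝓘(ℝ, E).tangent ∞ fg := contMDiff_zeroSection _ _
  let fv : N → TangentBundle 𝓘(ℝ, E) N := fun _ => TotalSpace.mk' E 1 v
  have sfv : ContMDiff 𝓘(ℝ, E) 𝓘(ℝ, E).tangent ∞ fv := contMDiff_const
  let F₁ : N → (TangentBundle 𝓘(ℝ, E) N × TangentBundle 𝓘(ℝ, E) N) := fun g => (fg g, fv g)
  have S₁ : ContMDiff 𝓘(ℝ, E) (𝓘(ℝ, E).tangent.prod 𝓘(ℝ, E).tangent) ∞ F₁ := sfg.prodMk sfv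
  let F₂ : (TangentBundle 𝓘(ℝ, E) N × TangentBundle 𝓘(ℝ, E) N) →
      TangentBundle (𝓘(ℝ, E).prod 𝓘(ℝ, E)) (N × N) :=
    (equivTangentBundleProd 𝓘(ℝ, E) N 𝓘(ℝ, E) N).symm
  have S₂ : ContMDiff (𝓘(ℝ, E).tangent.prod 𝓘(ℝ, E).tangent) (𝓘(ℝ, E).prod 𝓘(ℝ, E)).tangent ∞ F₂ :=
    contMDiff_equivTangentBundleProd_symm
  let F₃ : TangentBundle (𝓘(ℝ, E).prod 𝓘(ℝ, E)) (N × N) → TangentBundle 𝓘(ℝ, E) N :=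
    tangentMap (𝓘(ℝ, E).prod 𝓘(ℝ, E)) 𝓘(ℝ, E) (fun p : N × N => p.1 * p.2)
  have S₃ : ContMDiff (𝓘(ℝ, E).prod 𝓘(ℝ, E)).tangent 𝓘(ℝ, E).tangent ∞ F₃ :=
    ContMDiff.contMDiff_tangentMap (n := ∞) (contMDiff_mul 𝓘(ℝ, E) ∞) (by simp)
  convert! (S₃.comp S₂).comp S₁ with g
  · simp [F₁, F₂, F₃, fg, fv]
  · simp only [Function.comp_apply, tangentMap, F₃, F₂, F₁, fg, fv]
    rw [mfderiv_prod_eq_add_apply ((contMDiff_mul 𝓘(ℝ, E) ∞).mdifferentiableAt (by simp))]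
    change (mfderiv 𝓘(ℝ, E) 𝓘(ℝ, E) (fun x => g * x) 1 v : E) =
      (mfderiv 𝓘(ℝ, E) 𝓘(ℝ, E) (fun z => z * 1) g : E →L[ℝ] E) 0 +
        (mfderiv 𝓘(ℝ, E) 𝓘(ℝ, E) (fun x => g * x) 1 : E →L[ℝ] E) v
    rw [map_zero]
    exact (zero_add (_ : E)).symm

/-- Left-invariant vector fields in the chart at the identity, as linear functions of their value
at the identity. -/
def chartInvariantField (N : Type*) [TopologicalSpace N] [ChartedSpace E N] [Group N]
    [LieGroup 𝓘(ℝ, E) ∞ N] (z : E) : E →ₗ[ℝ] E where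
  toFun Y := chartField (1 : N) (mulInvariantVectorField (I := 𝓘(ℝ, E)) Y) z
  map_add' Y Y' := by
    have h := mulInvariantVectorField_add (I := 𝓘(ℝ, E)) (G := N) Y Y'
    refine (congrArg (fun V => chartField (1 : N) V z) h).trans ?_
    exact VectorField.mpullbackWithin_add_apply
  map_smul' c Y := by
    have h := mulInvariantVectorField_smul (I := 𝓘(ℝ, E)) (G := N) c Y
    refine (congrArg (fun V => chartField (1 : N) V z) h).trans ?_
    exact VectorField.mpullbackWithin_const_smul_apply

/-- The chain rule, with all tangent spaces identified with the model space. -/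
theorem mfderiv_apply_of_eq_comp {M : Type*} [TopologicalSpace M] [ChartedSpace E M]
    {f g h : M → M} {x y : M} (hf : MDifferentiableAt 𝓘(ℝ, E) 𝓘(ℝ, E) f x)
    (hg : MDifferentiableAt 𝓘(ℝ, E) 𝓘(ℝ, E) g y) (hy : f x = y) (hh : h = g ∘ f) (z : E) :
    (mfderiv 𝓘(ℝ, E) 𝓘(ℝ, E) h x : E → E) z =
      (mfderiv 𝓘(ℝ, E) 𝓘(ℝ, E) g y : E → E) ((mfderiv 𝓘(ℝ, E) 𝓘(ℝ, E) f x : E → E) z) := by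
  subst hy hh
  exact congrArg (fun l : E →L[ℝ] E => l z) (mfderiv_comp x hg hf)

theorem mfderiv_apply_of_eventuallyEq_id {M : Type*} [TopologicalSpace M] [ChartedSpace E M]
    {f : M → M} {x : M} (hf : f =ᶠ[nhds x] id) (z : E) :
    (mfderiv 𝓘(ℝ, E) 𝓘(ℝ, E) f x : E → E) z = z :=
  (congrArg (fun l : E →L[ℝ] E => l z) (hf.mfderiv_eq (I := 𝓘(ℝ, E)) (I' := 𝓘(ℝ, E)))).trans
    (congrArg (fun l : E →L[ℝ] E => l z) (mfderiv_id (I := 𝓘(ℝ, E)) (x := x)))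

theorem mulInvariantVectorField_one {N : Type*} [TopologicalSpace N] [ChartedSpace E N] [Group N]
    (Y : E) :
    (mulInvariantVectorField (I := 𝓘(ℝ, E)) (G := N) Y 1 : E) = Y :=
  mfderiv_apply_of_eventuallyEq_id (f := fun y : N => 1 * y) (.of_forall one_mul) Y

theorem chartInvariantField_self (Y : E) :
    chartInvariantField N (extChartAt 𝓘(ℝ, E) (1 : N) 1) Y = Y :=
  (chartField_self _).trans (mulInvariantVectorField_one (N := N) Y)

theorem contDiffAt_chartInvariantField [CompleteSpace E] (Y : E) :
    ContDiffAt ℝ ∞ (fun z => chartInvariantField N z Y) (extChartAt 𝓘(ℝ, E) (1 : N) 1) :=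
  contDiffAt_chartField (contMDiff_infty_mulInvariantVectorField _).contMDiffAt

/-- The derivative at time `0` of a moving left-invariant vector field along a moving point. -/
theorem hasDerivAt_chartInvariantField [FiniteDimensional ℝ E] {Y z : ℝ → E} {Y' z' : E}
    (hY : HasDerivAt Y Y' 0) (hz : HasDerivAt z z' 0)
    (hz0 : z 0 = extChartAt 𝓘(ℝ, E) (1 : N) 1) :
    HasDerivAt (fun t => chartInvariantField N (z t) (Y t))
      (Y' + fderiv ℝ (fun z => chartInvariantField N z (Y 0)) (extChartAt 𝓘(ℝ, E) (1 : N) 1) z')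
      0 := by
  have : CompleteSpace E := FiniteDimensional.complete ℝ E
  let b := Module.finBasis ℝ E
  -- Expanding in a basis separates the two dependences on `t`: scalar coordinates of `Y t` times
  -- fixed fields evaluated at `z t`.
  have hsum : ∀ z Y, chartInvariantField N z Y =
      ∑ i, (b.coord i).toContinuousLinearMap Y • chartInvariantField N z (b i) := fun z Y => by
    conv_lhs => rw [← b.sum_repr Y, map_sum]
    simp
  have hd : ∀ i, HasFDerivAt (fun z => chartInvariantField N z (b i))
      (fderiv ℝ (fun z => chartInvariantField N z (b i)) (extChartAt 𝓘(ℝ, E) (1 : N) 1)) (z 0) :=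
    fun i => by
      rw [hz0]
      exact ((contDiffAt_chartInvariantField (b i)).differentiableAt (by simp)).hasFDerivAt
  have h1 : HasDerivAt (fun t => chartInvariantField N (z t) (Y t))
      (∑ i, ((b.coord i).toContinuousLinearMap (Y 0) •
        fderiv ℝ (fun z => chartInvariantField N z (b i)) (extChartAt 𝓘(ℝ, E) (1 : N) 1) z' +
        (b.coord i).toContinuousLinearMap Y' • chartInvariantField N (z 0) (b i))) 0 := by
    simp only [hsum _ (Y _)]
    refine HasDerivAt.fun_sum fun i _ => ?_
    exact (((b.coord i).toContinuousLinearMap.hasFDerivAt).comp_hasDerivAt (0 : ℝ) hY).fun_smul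
      ((hd i).comp_hasDerivAt (0 : ℝ) hz)
  have h2 : HasFDerivAt (fun z => chartInvariantField N z (Y 0))
      (∑ i, (b.coord i).toContinuousLinearMap (Y 0) •
        fderiv ℝ (fun z => chartInvariantField N z (b i)) (extChartAt 𝓘(ℝ, E) (1 : N) 1)) (z 0) := by
    simp only [hsum _ (Y 0)]
    exact HasFDerivAt.fun_sum fun i _ => (hd i).const_smul _
  refine h1.congr_deriv ?_
  rw [Finset.sum_add_distrib, ← hsum, add_comm, hz0, chartInvariantField_self, ← hz0, h2.fderiv]
  simp only [sum_apply, smul_apply, hz0]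

/-- A local flow `φ` of `X`, translated back to the identity, differentiates to the bracket. -/
theorem hasDerivAt_mfderiv_translated_flow [FiniteDimensional ℝ E] {φ : ℝ → N → N}
    {X : (x : N) → TangentSpace 𝓘(ℝ, E) x}
    (hφ : ContMDiffAt (𝓘(ℝ, ℝ).prod 𝓘(ℝ, E)) 𝓘(ℝ, E) ∞ (fun p : ℝ × N => φ p.1 p.2) (0, 1))
    (hzero : ∀ᶠ x in nhds (1 : N), φ 0 x = x)
    (hint : ∀ᶠ x in nhds (1 : N), HasMFDerivAt 𝓘(ℝ, ℝ) 𝓘(ℝ, E) (fun t => φ t x) 0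
      ((1 : ℝ →L[ℝ] ℝ).smulRight (X (φ 0 x)))) (Z : E) :
    HasDerivAt (F := E)
      (fun t => mfderiv 𝓘(ℝ, E) 𝓘(ℝ, E) (fun y => (φ t 1)⁻¹ * φ t y) 1 Z)
      (VectorField.mlieBracket 𝓘(ℝ, E) (mulInvariantVectorField (I := 𝓘(ℝ, E)) Z) X 1) 0 := by
  have : CompleteSpace E := FiniteDimensional.complete ℝ E
  set χ := extChartAt 𝓘(ℝ, E) (1 : N) with hχ
  have h01 : φ 0 1 = 1 := hzero.self_of_nhds
  have hc1 : ContMDiffAt 𝓘(ℝ, ℝ) 𝓘(ℝ, E) ∞ (fun t => φ t 1) 0 :=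
    ContMDiffAt.comp (0 : ℝ) (f := fun t : ℝ => ((t, 1) : ℝ × N)) hφ
      (contMDiffAt_id.prodMk contMDiffAt_const)
  have hψ : ContMDiffAt (𝓘(ℝ, ℝ).prod 𝓘(ℝ, E)) 𝓘(ℝ, E) ∞
      (fun p : ℝ × N => (φ p.1 1)⁻¹ * φ p.1 p.2) (0, 1) :=
    (ContMDiffAt.comp ((0, 1) : ℝ × N) (f := fun p : ℝ × N => p.1) hc1 contMDiffAt_fst).inv.mul hφ
  have hmd : ∀ᶠ t in nhds (0 : ℝ), MDifferentiableAt 𝓘(ℝ, E) 𝓘(ℝ, E) (φ t) 1 := by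
    have h1 : ∀ᶠ p in nhds ((0, 1) : ℝ × N), ContMDiffAt (𝓘(ℝ, ℝ).prod 𝓘(ℝ, E)) 𝓘(ℝ, E) 1
        (fun p : ℝ × N => φ p.1 p.2) p := contMDiffAt_iff_contMDiffAt_nhds (by simp) |>.1 (hφ.of_le (by simp))
    have hc : ContinuousAt (fun t : ℝ => ((t, 1) : ℝ × N)) 0 := by fun_prop
    filter_upwards [hc.eventually h1] with t ht
    exact (ContMDiffAt.comp (1 : N) (f := fun x : N => ((t, x) : ℝ × N)) ht
      (contMDiffAt_const.prodMk contMDiffAt_id)).mdifferentiableAt (by simp)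
  have hmul : ∀ g x : N, MDifferentiableAt 𝓘(ℝ, E) 𝓘(ℝ, E) (fun y => g * y) x := fun g x =>
    (contMDiff_mul_left (I := 𝓘(ℝ, E)) (n := ∞)).mdifferentiableAt (by simp)
  have hT : (fun t => (mfderiv 𝓘(ℝ, E) 𝓘(ℝ, E) (fun y => (φ t 1)⁻¹ * φ t y) 1 Z : E)) =ᶠ[nhds 0]
      fun t => fderiv ℝ (chartMap (1 : N) 1 fun y => (φ t 1)⁻¹ * φ t y) (χ 1) Z := by
    filter_upwards [hmd] with t ht
    exact (fderiv_chartMap_self ((hmul (φ t 1)⁻¹ (φ t 1)).comp (1 : N) ht) (by simp) Z).symm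
  have hTd := (hasDerivAt_fderiv_right (((contDiffAt_chartMap (x₁ := (1 : N))
    (φ := fun t y => (φ t 1)⁻¹ * φ t y) hψ (by simp))).of_le ENat.LEInfty.out)
    Z).congr_of_eventuallyEq hT
  have hT0 : (mfderiv 𝓘(ℝ, E) 𝓘(ℝ, E) (fun y => (φ 0 1)⁻¹ * φ 0 y) 1 Z : E) = Z := by
    refine mfderiv_apply_of_eventuallyEq_id ?_ Z
    filter_upwards [hzero] with y hy
    simp [hy, h01]
  have hcurve : HasDerivAt (fun t => χ (φ t 1)) (X 1 : E) 0 := by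
    have := hasDerivAt_extChartAt_comp (x₀ := (1 : N)) hint.self_of_nhds (by simp [h01])
    rw [h01] at this
    rwa [chartField_self] at this
  -- The time derivative of `dφ_t Z` at `0` is computed in two ways. Exchanging derivatives gives
  -- `DX · Z`.
  have hD := hasDerivAt_fderiv_right ((contDiffAt_chartMap (x₁ := (1 : N)) hφ
    (by simp [h01])).of_le ENat.LEInfty.out) Z
  have hX : (fun x => deriv (fun t => chartMap (1 : N) 1 (φ t) x) 0) =ᶠ[nhds (χ 1)]
      chartField (1 : N) X := by
    have hc : ContinuousAt χ.symm (χ 1) := continuousAt_extChartAt_symm_self 1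
    have hx1 : χ.symm (χ 1) = 1 := extChartAt_to_inv 1
    rw [ContinuousAt, hx1] at hc
    filter_upwards [hc.eventually hint, hc.eventually hzero,
      hc.eventually (extChartAt_source_mem_nhds (I := 𝓘(ℝ, E)) (1 : N)),
      extChartAt_target_mem_nhds (I := 𝓘(ℝ, E)) (1 : N)] with x h1 h2 h3 h4
    refine (hasDerivAt_extChartAt_comp (x₀ := (1 : N)) h1 (by rwa [h2])).deriv.trans ?_
    rw [h2, ← hχ, χ.right_inv h4]
  rw [hX.fderiv_eq] at hD
  -- Second computation: `φ_t` is left translation by `φ_t 1` after the translated flow, so `dφ_t Z`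
  -- is the left-invariant field of the moving vector `T_t Z` at `φ_t 1`, with derivative `T' +
  -- D(Z^L) · X`. Comparison gives `T' = [Z^L, X]`.
  have hev : (fun t => fderiv ℝ (chartMap (1 : N) 1 (φ t)) (χ 1) Z) =ᶠ[nhds 0] fun t =>
      chartInvariantField N (χ (φ t 1))
        (mfderiv 𝓘(ℝ, E) 𝓘(ℝ, E) (fun y => (φ t 1)⁻¹ * φ t y) 1 Z) := by
    have hc : Filter.Tendsto (fun t => φ t 1) (nhds 0) (nhds 1) := by
      have := hc1.continuousAt
      rwa [ContinuousAt, h01] at this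
    filter_upwards [hmd, hc.eventually (extChartAt_source_mem_nhds (I := 𝓘(ℝ, E)) (1 : N))]
      with t ht hs
    rw [fderiv_chartMap ht hs]
    refine Eq.trans ?_ (chartField_extChartAt _ hs).symm
    congr 1
    exact mfderiv_apply_of_eq_comp ((hmul (φ t 1)⁻¹ (φ t 1)).comp (1 : N) ht) (hmul (φ t 1) 1)
      (by simp) (funext fun y => by simp) Z
  have hE := hasDerivAt_chartInvariantField (N := N) hTd hcurve (by rw [h01])
  have heq := (hD.congr_of_eventuallyEq hev.symm).unique hE
  rw [hT0] at heq
  refine hTd.congr_deriv ((eq_sub_of_add_eq heq.symm).trans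
    (Eq.trans ?_ (mlieBracket_eq_chartField _ _).symm))
  exact congrArg (fun w : E => fderiv ℝ (chartField (1 : N) X) (χ 1) w -
    fderiv ℝ (fun z => chartInvariantField N z Z) (χ 1) (X 1))
    (mulInvariantVectorField_one (N := N) Z).symm

end LieGroupFlows

/-! ### One-parameter subgroups -/

section OneParameterSubgroups

variable {E : Type*} [NormedAddCommGroup E] [NormedSpace ℝ E]
  {N : Type*} [TopologicalSpace N] [ChartedSpace E N] [Group N] [LieGroup 𝓘(ℝ, E) ∞ N]

theorem mdifferentiableAt_leftTranslation (g x : N) :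
    MDifferentiableAt 𝓘(ℝ, E) 𝓘(ℝ, E) (fun y => g * y) x :=
  (contMDiff_mul_left (I := 𝓘(ℝ, E)) (n := ∞)).mdifferentiableAt (by simp)

theorem mdifferentiableAt_rightTranslation (g x : N) :
    MDifferentiableAt 𝓘(ℝ, E) 𝓘(ℝ, E) (fun y => y * g) x :=
  (contMDiff_mul_right (I := 𝓘(ℝ, E)) (n := ∞)).mdifferentiableAt (by simp)

theorem mfderiv_mul_left_mulInvariantVectorField (A : E) (g x : N) :
    (mfderiv 𝓘(ℝ, E) 𝓘(ℝ, E) (fun y => g * y) x : E → E)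
      (mulInvariantVectorField (I := 𝓘(ℝ, E)) A x) =
      mulInvariantVectorField (I := 𝓘(ℝ, E)) A (g * x) :=
  (mfderiv_apply_of_eq_comp (mdifferentiableAt_leftTranslation x 1) (mdifferentiableAt_leftTranslation g x)
    (mul_one x) (funext fun y => mul_assoc g x y) A).symm

theorem HasMFDerivAt.mul_left_mulInvariantVectorField {A : E} {γ : ℝ → N} {t : ℝ} (g : N)
    (h : HasMFDerivAt 𝓘(ℝ, ℝ) 𝓘(ℝ, E) γ t
      ((1 : ℝ →L[ℝ] ℝ).smulRight (mulInvariantVectorField (I := 𝓘(ℝ, E)) A (γ t)))) :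
    HasMFDerivAt 𝓘(ℝ, ℝ) 𝓘(ℝ, E) (fun t => g * γ t) t
      ((1 : ℝ →L[ℝ] ℝ).smulRight (mulInvariantVectorField (I := 𝓘(ℝ, E)) A (g * γ t))) := by
  have h2 := (mdifferentiableAt_leftTranslation (E := E) g (γ t)).hasMFDerivAt.comp t h
  refine h2.congr_mfderiv (ContinuousLinearMap.ext fun a => ?_)
  refine (map_smul (mfderiv 𝓘(ℝ, E) 𝓘(ℝ, E) (fun y => g * y) (γ t) : E →L[ℝ] E)
    (show ℝ from a) (mulInvariantVectorField (I := 𝓘(ℝ, E)) A (γ t) : E)).trans ?_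
  exact congrArg (fun w : E => (show ℝ from a) • w)
    (mfderiv_mul_left_mulInvariantVectorField A g (γ t))

/-- Left-invariant vector fields are complete. -/
theorem exists_isMIntegralCurve_mulInvariantVectorField [CompleteSpace E] [T2Space N] (A : E) :
    ∃ γ : ℝ → N, γ 0 = 1 ∧ IsMIntegralCurve γ (mulInvariantVectorField (I := 𝓘(ℝ, E)) A) := by
  have hA : ContMDiff 𝓘(ℝ, E) 𝓘(ℝ, E).tangent 1 (fun g : N =>
      (⟨g, mulInvariantVectorField (I := 𝓘(ℝ, E)) A g⟩ : TangentBundle 𝓘(ℝ, E) N)) :=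
    (contMDiff_infty_mulInvariantVectorField _).of_le (by simp)
  have : IsManifold 𝓘(ℝ, E) 1 N := .of_le (n := ∞) (by simp)
  obtain ⟨γ, h0, hγ⟩ := exists_isMIntegralCurveAt_of_contMDiffAt_boundaryless (t₀ := 0)
    (hA.contMDiffAt (x := 1))
  obtain ⟨ε, hε, hγ⟩ := isMIntegralCurveAt_iff'.1 hγ
  rw [Real.ball_eq_Ioo, zero_sub, zero_add] at hγ
  -- Left translates of one local integral curve give the same existence time `ε` at every point,
  -- which forces completeness.
  refine exists_isMIntegralCurve_of_isMIntegralCurveOn hA hε (fun x => ⟨fun t => x * γ t,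
    by simp [h0], fun t ht => ?_⟩) 1
  exact (((hγ t ht).hasMFDerivAt (isOpen_Ioo.mem_nhds ht)).mul_left_mulInvariantVectorField
    x).hasMFDerivWithinAt

theorem IsMIntegralCurve.map_add_of_mulInvariantVectorField [CompleteSpace E] [T2Space N] {A : E}
    {γ : ℝ → N} (h0 : γ 0 = 1)
    (hγ : IsMIntegralCurve γ (mulInvariantVectorField (I := 𝓘(ℝ, E)) A)) (s t : ℝ) :
    γ (s + t) = γ s * γ t := by
  have hA : ContMDiff 𝓘(ℝ, E) 𝓘(ℝ, E).tangent 1 (fun g : N =>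
      (⟨g, mulInvariantVectorField (I := 𝓘(ℝ, E)) A g⟩ : TangentBundle 𝓘(ℝ, E) N)) :=
    (contMDiff_infty_mulInvariantVectorField _).of_le (by simp)
  have : IsManifold 𝓘(ℝ, E) 1 N := .of_le (n := ∞) (by simp)
  have h1 : IsMIntegralCurve (fun t => γ s * γ t)
      (mulInvariantVectorField (I := 𝓘(ℝ, E)) A) := fun t =>
    (hγ t).mul_left_mulInvariantVectorField (γ s)
  have h2 := isMIntegralCurve_Ioo_eq_of_contMDiff_boundaryless (t₀ := 0) hA (hγ.comp_add s) h1
    (by simp [h0])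
  simpa [add_comm] using congrFun h2 t

theorem IsMIntegralCurve.contMDiff_of_mulInvariantVectorField [CompleteSpace E] [T2Space N] {A : E}
    {γ : ℝ → N} (h0 : γ 0 = 1)
    (hγ : IsMIntegralCurve γ (mulInvariantVectorField (I := 𝓘(ℝ, E)) A)) :
    ContMDiff 𝓘(ℝ, ℝ) 𝓘(ℝ, E) ∞ γ := by
  have : IsManifold 𝓘(ℝ, E) 1 N := .of_le (n := ∞) (by simp)
  have hc : Filter.Tendsto γ (nhds 0) (nhds 1) := by
    have := hγ.continuous.continuousAt (x := 0)
    rwa [ContinuousAt, h0] at this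
  have hs := hc.eventually (extChartAt_source_mem_nhds (I := 𝓘(ℝ, E)) (1 : N))
  have h1 : ContDiffAt ℝ ∞ (fun t => extChartAt 𝓘(ℝ, E) (1 : N) (γ t)) 0 := by
    refine contDiffAt_of_eventually_hasDerivAt (w := chartField (1 : N)
      (mulInvariantVectorField (I := 𝓘(ℝ, E)) A)) ?_ ?_
    · rw [h0]
      exact contDiffAt_chartField (contMDiff_infty_mulInvariantVectorField _).contMDiffAt
    · filter_upwards [hs] with t ht using hasDerivAt_extChartAt_comp (hγ t) ht
  have h2 : ContMDiffAt 𝓘(ℝ, ℝ) 𝓘(ℝ, E) ∞ γ 0 := by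
    refine ContMDiffAt.congr_of_eventuallyEq (ContMDiffAt.comp_of_eq
      ((contMDiffOn_extChartAt_symm (I := 𝓘(ℝ, E)) (1 : N)).contMDiffAt
        (extChartAt_target_mem_nhds (1 : N))) h1.contMDiffAt (by rw [h0])) ?_
    filter_upwards [hs] with t ht using ((extChartAt 𝓘(ℝ, E) (1 : N)).left_inv ht).symm
  intro t
  have h3 : γ = fun s => γ t * γ (s - t) := funext fun s => by
    rw [← hγ.map_add_of_mulInvariantVectorField h0, add_sub_cancel]
  rw [h3]
  exact contMDiffAt_const.mul (ContMDiffAt.comp_of_eq h2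
    (contDiff_id.sub contDiff_const).contMDiff.contMDiffAt (by simp))

end OneParameterSubgroups

/-! ### Linear algebra of the Minkowski form -/

section MinkowskiForm

variable {m : ℕ}

theorem minkowski_comm (v w : Fin (m + 2) → ℝ) : minkowski v w = minkowski w v := by
  simp only [minkowski, mul_comm (v _)]
  ring

theorem minkowski_add_left (v v' w : Fin (m + 2) → ℝ) :
    minkowski (v + v') w = minkowski v w + minkowski v' w := by
  simp only [minkowski, Pi.add_apply, add_mul, Finset.sum_add_distrib]
  ring

theorem nullK_one : nullK m 1 = 0 := by simp [nullK]

theorem nullK_ne_zero : nullK m ≠ 0 := fun h => by simpa [nullK] using congrFun h 0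

theorem nullL_one : nullL m 1 = 1 := by simp [nullL]

/-- The Minkowski form is semidefinite on the orthogonal complement of `k`. -/
theorem eq_smul_nullK_of_minkowski_self {w : Fin (m + 2) → ℝ} (hw : w 1 = 0)
    (h : minkowski w w = 0) : w = w 0 • nullK m := by
  have h2 : ∑ i : Fin m, w i.succ.succ * w i.succ.succ = 0 := by simpa [minkowski, hw] using h
  rw [Finset.sum_eq_zero_iff_of_nonneg fun i _ => mul_self_nonneg _] at h2
  funext j
  refine Fin.cases (by simp [nullK]) (fun j => Fin.cases ?_ (fun i => ?_) j) j
  · simpa [nullK] using hw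
  · have : (i.succ.succ : Fin (m + 2)) ≠ 0 := Fin.succ_ne_zero _
    simpa [nullK, this] using h2 i (Finset.mem_univ i)

/-- A nilpotent endomorphism that is skew on the orthogonal complement of `k` maps this complement
to the line of `k`. -/
theorem exists_eq_smul_nullK_of_isNilpotent {D : (Fin (m + 2) → ℝ) →ₗ[ℝ] (Fin (m + 2) → ℝ)}
    (hD : IsNilpotent D) (hperp : ∀ w, w 1 = 0 → D w 1 = 0)
    (hskew : ∀ w, w 1 = 0 → minkowski (D w) w = 0) {w : Fin (m + 2) → ℝ} (hw : w 1 = 0) :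
    ∃ c : ℝ, D w = c • nullK m := by
  have hpolar : ∀ v w, v 1 = 0 → w 1 = 0 → minkowski (D v) w = -minkowski (D w) v :=
    fun v w hv hw => by
      have h := hskew (v + w) (by simp [hv, hw])
      rw [map_add, minkowski_add_left, minkowski_comm _ (v + w), minkowski_comm _ (v + w),
        minkowski_add_left, minkowski_add_left, minkowski_comm v, hskew v hv, minkowski_comm w (D w),
        hskew w hw, minkowski_comm w, minkowski_comm v] at h
      linarith
  have hpow : ∀ j, ∀ w, w 1 = 0 → (D ^ j) w 1 = 0 := by
    intro j
    induction j with
    | zero => simp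
    | succ j ih => intro w hw; rw [pow_succ']; exact hperp _ (ih w hw)
  -- Descent on the exponent: if `D^(j+2) w` is null it is a multiple of `k`, so `η(D^(j+1) w,
  -- D^(j+1) w) = -η(D^(j+2) w, D^j w) = 0`. Starting at `p + 1` instead of `p` keeps the exponent
  -- positive.
  have hnull : ∀ j, (∀ w, w 1 = 0 → minkowski ((D ^ (j + 1)) w) ((D ^ (j + 1)) w) = 0) →
      ∀ w, w 1 = 0 → minkowski (D w) (D w) = 0 := by
    intro j
    induction j with
    | zero => intro h w hw; simpa using h w hw
    | succ j ih =>
      intro h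
      refine ih fun w hw => ?_
      have h1 : (D ^ (j + 1)) w = D ((D ^ j) w) := by rw [pow_succ']; rfl
      have h2 : (D ^ (j + 1 + 1)) w = D ((D ^ (j + 1)) w) := by rw [pow_succ']; rfl
      have h3 := hpolar _ _ (hpow j w hw) (hpow (j + 1) w hw)
      rw [← h1, ← h2] at h3
      rw [h3, eq_smul_nullK_of_minkowski_self (hpow _ w hw) (h w hw), minkowski_smul_left,
        minkowski_nullK, hpow j w hw, mul_zero, neg_zero]
  obtain ⟨p, hp⟩ := hD
  refine ⟨_, eq_smul_nullK_of_minkowski_self (hperp w hw) (hnull p (fun w _ => ?_) w hw)⟩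
  rw [pow_succ', hp, mul_zero]
  simp [minkowski]

/-- A nilpotent endomorphism that preserves a hyperplane maps everything into it. -/
theorem apply_one_eq_zero_of_isNilpotent {D : (Fin (m + 2) → ℝ) →ₗ[ℝ] (Fin (m + 2) → ℝ)}
    (hD : IsNilpotent D) (hperp : ∀ w, w 1 = 0 → D w 1 = 0) (z : Fin (m + 2) → ℝ) :
    D z 1 = 0 := by
  -- The coordinate `1` identifies `ℝⁿ / {k}^⊥` with `ℝ`, where `D` acts by the scalar `D l 1`.
  have h : ∀ z, D z 1 = z 1 * D (nullL m) 1 := fun z => by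
    have := hperp (z - z 1 • nullL m) (by simp [nullL_one])
    rw [map_sub, map_smul] at this
    simpa [sub_eq_zero] using this
  have hp : ∀ p, (D ^ p) (nullL m) 1 = (D (nullL m) 1) ^ p := by
    intro p
    induction p with
    | zero => simp [nullL_one]
    | succ p ih => rw [pow_succ', Module.End.mul_apply, h, ih, pow_succ]
  obtain ⟨p, hp0⟩ := hD
  have h0 := hp p
  rw [hp0] at h0
  rw [h, eq_zero_of_pow_eq_zero h0.symm, mul_zero]

theorem groupGN_apply_one {f : (Fin (m + 2) → ℝ) ≃ₗ[ℝ] (Fin (m + 2) → ℝ)} (hf : f ∈ groupGN m)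
    {w : Fin (m + 2) → ℝ} (hw : w 1 = 0) : f w 1 = 0 := by
  obtain ⟨⟨c, hc⟩, -, h⟩ := hf
  have h2 : ∀ z, c * f z 1 = z 1 := fun z => by
    rw [← minkowski_nullK (f z), ← minkowski_smul_left, ← hc, h, minkowski_nullK]
  have h3 := h2 (nullL m)
  have hc0 : c ≠ 0 := by
    rintro rfl
    simp [nullL_one] at h3
  have := h2 w
  rw [hw] at this
  exact (mul_eq_zero.1 this).resolve_left hc0

/-- Maps that are unipotent along the flag `ℝ k ⊆ {k}^⊥ ⊆ ℝⁿ`, and trivial on `{k}^⊥ / ℝ k`, belong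
to `GN`. -/
theorem exists_mem_groupGN {S : (Fin (m + 2) → ℝ) →ₗ[ℝ] (Fin (m + 2) → ℝ)}
    (hk : S (nullK m) = nullK m) (hperp : ∀ w, w 1 = 0 → ∃ c : ℝ, S w = w + c • nullK m)
    (hone : ∀ z, S z 1 = z 1) : ∃ g ∈ groupGN m, S = g.toLinearMap := by
  have hinj : Function.Injective S := by
    rw [← LinearMap.ker_eq_bot, LinearMap.ker_eq_bot']
    intro z hz
    have hz1 : z 1 = 0 := by rw [← hone z, hz]; rfl
    obtain ⟨c, hc⟩ := hperp z hz1
    have hzk : z = -c • nullK m := by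
      rw [hz] at hc
      rw [neg_smul, eq_neg_iff_add_eq_zero, ← hc]
    rw [hzk, map_smul, hk] at hz
    rw [hzk, hz]
  refine ⟨LinearEquiv.ofInjectiveEndo S hinj, ⟨⟨1, ?_⟩, fun w w' hw hw' => ?_, fun z => ?_⟩, ?_⟩
  · simpa using hk
  · rw [minkowski_nullK] at hw hw'
    obtain ⟨c, hc⟩ := hperp w hw
    obtain ⟨c', hc'⟩ := hperp w' hw'
    simp only [LinearEquiv.coe_ofInjectiveEndo, hc, hc']
    rw [minkowski_add_left, minkowski_smul_left, minkowski_nullK, minkowski_comm,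
      minkowski_add_left, minkowski_smul_left, minkowski_nullK, minkowski_comm w']
    simp [hw, hw', nullK_one]
  · simp only [LinearEquiv.coe_ofInjectiveEndo, hk]
    rw [minkowski_nullK, minkowski_nullK, hone]
  · rfl

theorem HasDerivAt.minkowski_self {y : ℝ → Fin (m + 2) → ℝ} {y' : Fin (m + 2) → ℝ} {t : ℝ}
    (hy : HasDerivAt y y' t) :
    HasDerivAt (fun t => minkowski (y t) (y t)) (2 * minkowski y' (y t)) t := by
  have h := hasDerivAt_pi.1 hy
  have h2 := (((h 0).mul (h 1)).add ((h 1).mul (h 0))).add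
    (HasDerivAt.fun_sum (u := Finset.univ) fun (i : Fin m) _ =>
      (h i.succ.succ).mul (h i.succ.succ))
  refine h2.congr_deriv ?_
  simp only [minkowski, Finset.sum_add_distrib, mul_comm (y t _) (y' _)]
  ring

/-- The one-parameter group generated by an endomorphism `D` of the flag
`ℝ k ⊆ {k}^⊥ ⊆ ℝⁿ` that is zero on the graded pieces consists of elements of `GN`. -/
theorem exists_mem_groupGN_of_hasDerivAt
    {D : (Fin (m + 2) → ℝ) →ₗ[ℝ] (Fin (m + 2) → ℝ)}
    {S : ℝ → (Fin (m + 2) → ℝ) →ₗ[ℝ] (Fin (m + 2) → ℝ)} (h0 : ∀ w, S 0 w = w)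
    (hS : ∀ w t, HasDerivAt (fun t => S t w) (S t (D w)) t)
    (hk : D (nullK m) = 0) (hperp : ∀ w, w 1 = 0 → ∃ c : ℝ, D w = c • nullK m)
    (hone : ∀ z, D z 1 = 0) (t : ℝ) : ∃ g ∈ groupGN m, S t = g.toLinearMap := by
  -- The equation is solved up the flag: `S t k` is constant, then `S t w = w + t c k` on `{k}^⊥`,
  -- then the coordinate `1` of `S t z` is constant.
  have hSk : ∀ t, S t (nullK m) = nullK m := fun t => by
    rw [← h0 (nullK m), h0 (nullK m)]
    have h := is_const_of_deriv_eq_zero (f := fun t => S t (nullK m))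
      (fun t => (hS _ t).differentiableAt) (fun t => by rw [(hS _ t).deriv, hk, map_zero]) t 0
    exact h.trans (h0 _)
  have hSperp : ∀ w t, w 1 = 0 → ∃ c : ℝ, S t w = w + c • nullK m := fun w t hw => by
    obtain ⟨c, hc⟩ := hperp w hw
    have hd : ∀ t, HasDerivAt (fun t => S t w - (t * c) • nullK m) 0 t := fun t => by
      refine ((hS w t).sub (((hasDerivAt_id t).mul_const c).smul_const (nullK m))).congr_deriv ?_
      rw [hc, map_smul, hSk]
      simp
    have h := is_const_of_deriv_eq_zero (fun t => (hd t).differentiableAt)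
      (fun t => (hd t).deriv) t 0
    refine ⟨t * c, ?_⟩
    simpa [h0, sub_eq_iff_eq_add] using h
  refine exists_mem_groupGN (hSk t) (fun w => hSperp w t) fun z => ?_
  have hd : ∀ t, HasDerivAt (fun t => S t z 1) 0 t := fun t => by
    refine (hasDerivAt_pi.1 (hS z t) 1).congr_deriv ?_
    obtain ⟨c, hc⟩ := hSperp (D z) t (hone z)
    simp [hc, hone, nullK_one]
  have h := is_const_of_deriv_eq_zero (fun t => (hd t).differentiableAt) (fun t => (hd t).deriv) t 0
  rw [h, h0]

end MinkowskiForm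

/-! ### Distributions of `GN`-structures -/

section Distributions

variable {E : Type*} [NormedAddCommGroup E] [NormedSpace ℝ E]
  {H : Type*} [TopologicalSpace H] {I : ModelWithCorners ℝ E H}
  {M : Type*} [TopologicalSpace M] [ChartedSpace H M] [IsManifold I ∞ M] {m : ℕ}

/-- Elements of `GN` preserve `ℝ k`, so all frames contribute the same line to the supremum. -/
theorem GStructure.mem_nullLine_iff (P : GNStructure I M m) {x : M}
    {u : (Fin (m + 2) → ℝ) →ₗ[ℝ] TangentSpace I x} (hu : u ∈ P.frames x) (v : TangentSpace I x) :
    v ∈ P.nullLine x ↔ ∃ c : ℝ, v = c • u (nullK m) := by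
  have h : P.nullLine x = (Submodule.span ℝ {nullK m}).map u := by
    refine le_antisymm (iSup₂_le fun v hv => ?_)
      (le_iSup₂ (f := fun (v : (Fin (m + 2) → ℝ) →ₗ[ℝ] TangentSpace I x) (_ : v ∈ P.frames x) =>
        (Submodule.span ℝ {nullK m}).map v) u hu)
    obtain ⟨g, ⟨⟨c, hc⟩, -, -⟩, rfl⟩ := (P.mem_iff x u hu v).1 hv
    rintro _ ⟨w, hw, rfl⟩
    obtain ⟨a, rfl⟩ := Submodule.mem_span_singleton.1 hw
    exact ⟨g (a • nullK m), Submodule.mem_span_singleton.2 ⟨a * c, by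
      rw [map_smul, hc, smul_smul]⟩, rfl⟩
  rw [h, Submodule.map_span, Set.image_singleton, Submodule.mem_span_singleton]
  exact exists_congr fun c => eq_comm

theorem GStructure.mem_nullHyperplane_iff (P : GNStructure I M m) {x : M}
    {u : (Fin (m + 2) → ℝ) →ₗ[ℝ] TangentSpace I x} (hu : u ∈ P.frames x) (v : TangentSpace I x) :
    v ∈ P.nullHyperplane x ↔ ∃ w, w 1 = 0 ∧ u w = v := by
  have hK : ∀ w : Fin (m + 2) → ℝ, w ∈ Submodule.span ℝ {w | minkowski (nullK m) w = 0} ↔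
      w 1 = 0 := fun w => by
    refine ⟨fun hw => ?_, fun hw => Submodule.subset_span (by simpa [minkowski_nullK] using hw)⟩
    induction hw using Submodule.span_induction with
    | mem w hw => simpa [minkowski_nullK] using hw
    | zero => rfl
    | add v w _ _ hv hw => simp [hv, hw]
    | smul c w _ hw => simp [hw]
  have h : P.nullHyperplane x = (Submodule.span ℝ {w | minkowski (nullK m) w = 0}).map u := by
    refine le_antisymm (iSup₂_le fun v hv => ?_)
      (le_iSup₂ (f := fun (v : (Fin (m + 2) → ℝ) →ₗ[ℝ] TangentSpace I x) (_ : v ∈ P.frames x) =>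
        (Submodule.span ℝ {w | minkowski (nullK m) w = 0}).map v) u hu)
    obtain ⟨g, hg, rfl⟩ := (P.mem_iff x u hu v).1 hv
    rintro _ ⟨w, hw, rfl⟩
    exact ⟨g w, (hK _).2 (groupGN_apply_one hg ((hK w).1 hw)), rfl⟩
  rw [h, Submodule.mem_map]
  exact exists_congr fun w => and_congr_left' (hK w)

theorem GStructure.PreservedAt.mem_nullHyperplane {P : GNStructure I M m} {f : M → M} {x : M}
    (hf : P.PreservedAt f x) {v : TangentSpace I x} (hv : v ∈ P.nullHyperplane x) :
    mfderiv I I f x v ∈ P.nullHyperplane (f x) := by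
  obtain ⟨u, hu⟩ := P.nonempty x
  obtain ⟨w, hw, rfl⟩ := (P.mem_nullHyperplane_iff hu v).1 hv
  exact (P.mem_nullHyperplane_iff (hf u hu) _).2 ⟨w, hw, rfl⟩

/-- Moves a frame along equalities of base points such as `x * 1 = x`; all tangent spaces are
definitionally `E`. -/
theorem GStructure.mem_frames_congr {n : ℕ} {G : Subgroup ((Fin n → ℝ) ≃ₗ[ℝ] (Fin n → ℝ))}
    (P : GStructure I M G) {x y : M} (h : x = y) (u : (Fin n → ℝ) →ₗ[ℝ] E) :
    (show (Fin n → ℝ) →ₗ[ℝ] TangentSpace I x from u) ∈ P.frames x ↔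
      (show (Fin n → ℝ) →ₗ[ℝ] TangentSpace I y from u) ∈ P.frames y := by
  subst h
  rfl

theorem GStructure.PreservedAt.comp {n : ℕ} {G : Subgroup ((Fin n → ℝ) ≃ₗ[ℝ] (Fin n → ℝ))}
    {P : GStructure I M G} {f g : M → M} {x y : M} (hg : P.PreservedAt g y)
    (hf : P.PreservedAt f x) (hy : f x = y) (hgd : MDifferentiableAt I I g y)
    (hfd : MDifferentiableAt I I f x) : P.PreservedAt (g ∘ f) x := by
  subst hy
  intro u hu
  rw [mfderiv_comp x hgd hfd]
  exact hg _ (hf u hu)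

end Distributions

/-! ### Left-invariant structures and their distributions -/

section LeftInvariant

variable {E : Type*} [NormedAddCommGroup E] [NormedSpace ℝ E]
  {N : Type*} [TopologicalSpace N] [ChartedSpace E N] [Group N] [LieGroup 𝓘(ℝ, E) ∞ N] {m : ℕ}

theorem GStructure.IsLeftInvariant.mem_nullLine_iff {P : GNStructure 𝓘(ℝ, E) N m}
    (hP : P.IsLeftInvariant) {u : (Fin (m + 2) → ℝ) →ₗ[ℝ] GroupLieAlgebra 𝓘(ℝ, E) N}
    (hu : u ∈ P.frames 1) {x : N} (v : TangentSpace 𝓘(ℝ, E) x) :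
    v ∈ P.nullLine x ↔
      ∃ c : ℝ, v = c • (mulInvariantVectorField (u (nullK m)) x : TangentSpace 𝓘(ℝ, E) x) :=
  P.mem_nullLine_iff ((P.mem_frames_congr (mul_one x)
    ((mfderiv 𝓘(ℝ, E) 𝓘(ℝ, E) (fun y => x * y) 1 : E →L[ℝ] E).toLinearMap ∘ₗ u)).1
    (hP x 1 u hu)) v

theorem GStructure.IsLeftInvariant.mem_nullHyperplane {P : GNStructure 𝓘(ℝ, E) N m}
    (hP : P.IsLeftInvariant) {A : E}
    (hA : (show TangentSpace 𝓘(ℝ, E) (1 : N) from A) ∈ P.nullHyperplane 1) (x : N) :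
    mulInvariantVectorField (I := 𝓘(ℝ, E)) A x ∈ P.nullHyperplane x := by
  have h : ∀ y, y = x → (mfderiv 𝓘(ℝ, E) 𝓘(ℝ, E) (x * ·) 1 A : E) ∈
      (P.nullHyperplane y : Submodule ℝ E) → (mfderiv 𝓘(ℝ, E) 𝓘(ℝ, E) (x * ·) 1 A : E) ∈
      (P.nullHyperplane x : Submodule ℝ E) := by
    rintro _ rfl
    exact id
  exact h _ (mul_one x) ((hP x 1).mem_nullHyperplane hA)

/-- If `Λ` is integrable, its value at the identity is a subalgebra. -/
theorem GStructure.IsLeftInvariant.lie_mem_nullHyperplane {P : GNStructure 𝓘(ℝ, E) N m}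
    (hP : P.IsLeftInvariant) (hint : IsIntegrableDistribution 𝓘(ℝ, E) P.nullHyperplane)
    {A B : GroupLieAlgebra 𝓘(ℝ, E) N} (hA : A ∈ P.nullHyperplane 1)
    (hB : B ∈ P.nullHyperplane 1) : ⁅A, B⁆ ∈ P.nullHyperplane 1 :=
  hint Set.univ isOpen_univ (mulInvariantVectorField A) (mulInvariantVectorField B)
    (contMDiff_infty_mulInvariantVectorField A).contMDiffOn
    (contMDiff_infty_mulInvariantVectorField B).contMDiffOn
    (fun x _ => hP.mem_nullHyperplane hA x) (fun x _ => hP.mem_nullHyperplane hB x) 1 trivial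

/-- A map preserving a left-invariant structure at the identity preserves it everywhere, if it
commutes with left translations up to left translations. -/
theorem GStructure.IsLeftInvariant.preservedAt {n : ℕ}
    {G : Subgroup ((Fin n → ℝ) ≃ₗ[ℝ] (Fin n → ℝ))} {P : GStructure 𝓘(ℝ, E) N G}
    (hP : P.IsLeftInvariant) {g : N} (h : P.PreservedAt (fun y => g⁻¹ * (y * g)) 1) (x : N) :
    P.PreservedAt (fun y => y * g) x := by
  have hd : MDifferentiableAt 𝓘(ℝ, E) 𝓘(ℝ, E) (fun y => g⁻¹ * (y * g)) 1 :=
    (mdifferentiableAt_leftTranslation g⁻¹ (1 * g)).comp (1 : N)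
      (mdifferentiableAt_rightTranslation g 1)
  -- Right translation by `g` is left translation by `x⁻¹`, then conjugation, then left translation
  -- by `x * g`.
  have h1 := h.comp (hP x⁻¹ x) (inv_mul_cancel x) hd (mdifferentiableAt_leftTranslation x⁻¹ x)
  have h2 := (hP (x * g) 1).comp h1 (by simp) (mdifferentiableAt_leftTranslation (x * g) 1)
    (MDifferentiableAt.comp (x : N) (by simpa using hd)
      (mdifferentiableAt_leftTranslation x⁻¹ x))
  convert h2 using 1
  ext y
  simp [mul_assoc]

end LeftInvariant

/-! ### Brackets with pointwise multiples -/

section Brackets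

variable {E : Type*} [NormedAddCommGroup E] [NormedSpace ℝ E] [CompleteSpace E]
  {M : Type*} [TopologicalSpace M] [ChartedSpace E M] [IsManifold 𝓘(ℝ, E) ∞ M]

/-- This is the Leibniz rule `[Z, f Y] = f [Z, Y] + (Z f) Y`. The factor is given only pointwise;
its differentiability comes from writing it in a chart as a quotient `l(X) / l(Y)`, with `l` a
functional nonzero on `Y x₀`. -/
theorem mlieBracket_eq_of_eventually_eq_smul {X Y Z : (x : M) → TangentSpace 𝓘(ℝ, E) x} {x₀ : M}
    (hX : ContMDiffAt 𝓘(ℝ, E) 𝓘(ℝ, E).tangent ∞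
      (fun x => (⟨x, X x⟩ : TangentBundle 𝓘(ℝ, E) M)) x₀)
    (hY : ContMDiffAt 𝓘(ℝ, E) 𝓘(ℝ, E).tangent ∞
      (fun x => (⟨x, Y x⟩ : TangentBundle 𝓘(ℝ, E) M)) x₀)
    (hY0 : Y x₀ ≠ 0) (hXY : ∀ᶠ x in nhds x₀, ∃ c : ℝ, X x = c • Y x) :
    ∃ c d : ℝ, X x₀ = c • Y x₀ ∧ VectorField.mlieBracket 𝓘(ℝ, E) Z X x₀ =
      c • VectorField.mlieBracket 𝓘(ℝ, E) Z Y x₀ + d • Y x₀ := by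
  set z₀ := extChartAt 𝓘(ℝ, E) x₀ x₀ with hz₀
  obtain ⟨l, hl0⟩ : ∃ l : E →L[ℝ] ℝ, l (Y x₀) ≠ 0 := SeparatingDual.exists_ne_zero (R := ℝ) hY0
  have hdX : DifferentiableAt ℝ (chartField x₀ X) z₀ :=
    (contDiffAt_chartField hX).differentiableAt (by simp)
  have hdY : DifferentiableAt ℝ (chartField x₀ Y) z₀ :=
    (contDiffAt_chartField hY).differentiableAt (by simp)
  have hlY : l (chartField x₀ Y z₀) ≠ 0 := by rwa [chartField_self]
  let f : E → ℝ := fun z => l (chartField x₀ X z) / l (chartField x₀ Y z)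
  have hf : DifferentiableAt ℝ f z₀ := by
    have h1 : DifferentiableAt ℝ (fun z => l (chartField x₀ X z)) z₀ :=
      l.differentiableAt.comp z₀ hdX
    have h2 : DifferentiableAt ℝ (fun z => l (chartField x₀ Y z)) z₀ :=
      l.differentiableAt.comp z₀ hdY
    simp only [f, div_eq_mul_inv]
    exact h1.fun_mul (h2.fun_inv hlY)
  have hev : chartField x₀ X =ᶠ[nhds z₀] fun z => f z • chartField x₀ Y z := by
    have hc : ContinuousAt (extChartAt 𝓘(ℝ, E) x₀).symm z₀ := continuousAt_extChartAt_symm_self x₀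
    rw [ContinuousAt, hz₀, extChartAt_to_inv] at hc
    filter_upwards [hc.eventually hXY, hc.eventually (extChartAt_source_mem_nhds (I := 𝓘(ℝ, E)) x₀),
      extChartAt_target_mem_nhds (I := 𝓘(ℝ, E)) x₀,
      (l.continuous.continuousAt.comp hdY.continuousAt).eventually_ne hlY] with z ⟨c, hc⟩ hs ht hz
    have h1 : chartField x₀ X z = c • chartField x₀ Y z := by
      rw [← (extChartAt 𝓘(ℝ, E) x₀).right_inv ht, chartField_extChartAt X hs,
        chartField_extChartAt Y hs, hc]
      exact map_smul (mfderiv 𝓘(ℝ, E) 𝓘(ℝ, E) (extChartAt 𝓘(ℝ, E) x₀) _ : E →L[ℝ] E) c _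
    have h2 : f z = c := by
      simp only [f, h1, map_smul, smul_eq_mul]
      exact mul_div_cancel_right₀ c hz
    rw [h2, h1]
  let x : E := X x₀
  let y : E := Y x₀
  let z : E := Z x₀
  have hx : chartField x₀ X z₀ = x := chartField_self X
  have hy : chartField x₀ Y z₀ = y := chartField_self Y
  have h0 : x = f z₀ • y := by
    rw [← hx, ← hy]
    exact hev.self_of_nhds
  refine ⟨f z₀, fderiv ℝ f z₀ z, h0, ?_⟩
  have hd : fderiv ℝ (chartField x₀ X) z₀ z =
      f z₀ • fderiv ℝ (chartField x₀ Y) z₀ z + fderiv ℝ f z₀ z • y := by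
    rw [hev.fderiv_eq, ← hy]
    exact congrArg (fun g : E →L[ℝ] E => g z) (hf.hasFDerivAt.fun_smul hdY.hasFDerivAt).fderiv
  refine (mlieBracket_eq_chartField Z X).trans (Eq.trans ?_ (congrArg
    (fun w : E => f z₀ • w + fderiv ℝ f z₀ z • y) (mlieBracket_eq_chartField Z Y)).symm)
  change fderiv ℝ (chartField x₀ X) z₀ z - fderiv ℝ (chartField x₀ Z) z₀ x =
    f z₀ • (fderiv ℝ (chartField x₀ Y) z₀ z - fderiv ℝ (chartField x₀ Z) z₀ y) +
      fderiv ℝ f z₀ z • y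
  rw [hd, h0, map_smul]
  module

end Brackets

/-! ### Left-invariant Kundt structures -/

section LeftInvariantKundt

variable {E : Type*} [NormedAddCommGroup E] [NormedSpace ℝ E] [FiniteDimensional ℝ E]
  {N : Type*} [TopologicalSpace N] [ChartedSpace E N] [Group N] [LieGroup 𝓘(ℝ, E) ∞ N] {m : ℕ}

/-- The adjoint action of `A` read in a frame at the identity. -/
def frameAd (u : (Fin (m + 2) → ℝ) ≃ₗ[ℝ] GroupLieAlgebra 𝓘(ℝ, E) N)
    (A : GroupLieAlgebra 𝓘(ℝ, E) N) : (Fin (m + 2) → ℝ) →ₗ[ℝ] (Fin (m + 2) → ℝ) :=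
  u.symm.toLinearMap ∘ₗ LieAlgebra.ad ℝ (GroupLieAlgebra 𝓘(ℝ, E) N) A ∘ₗ u.toLinearMap

theorem apply_frameAd (u : (Fin (m + 2) → ℝ) ≃ₗ[ℝ] GroupLieAlgebra 𝓘(ℝ, E) N)
    (A : GroupLieAlgebra 𝓘(ℝ, E) N) (w : Fin (m + 2) → ℝ) : u (frameAd u A w) = ⁅A, u w⁆ := by
  simp [frameAd]

theorem isNilpotent_frameAd [LieRing.IsNilpotent (GroupLieAlgebra 𝓘(ℝ, E) N)]
    (u : (Fin (m + 2) → ℝ) ≃ₗ[ℝ] GroupLieAlgebra 𝓘(ℝ, E) N)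
    (A : GroupLieAlgebra 𝓘(ℝ, E) N) : IsNilpotent (frameAd u A) := by
  obtain ⟨p, hp⟩ := LieAlgebra.nilpotent_ad_of_nilpotent_algebra ℝ (GroupLieAlgebra 𝓘(ℝ, E) N)
  refine ⟨p, ?_⟩
  have h : ∀ q w, u ((frameAd u A ^ q) w) =
      (LieAlgebra.ad ℝ (GroupLieAlgebra 𝓘(ℝ, E) N) A ^ q) (u w) := by
    intro q w
    induction q with
    | zero => rfl
    | succ q ih =>
      rw [pow_succ', pow_succ', Module.End.mul_apply, Module.End.mul_apply, apply_frameAd, ih]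
      rfl
  ext1 i
  refine LinearMap.ext fun w => u.injective ?_
  rw [LinearMap.comp_apply, h, hp A]
  simp

/-- A local Kundt field is infinitesimally skew along `Λ`. -/
theorem GStructure.minkowski_frameAd_eq_zero {P : GNStructure 𝓘(ℝ, E) N m}
    (hP : P.IsLeftInvariant) (hK : P.IsKundt)
    (u : (Fin (m + 2) → ℝ) ≃ₗ[ℝ] GroupLieAlgebra 𝓘(ℝ, E) N) (hu : u.toLinearMap ∈ P.frames 1)
    {w : Fin (m + 2) → ℝ} (hw : w 1 = 0) :
    minkowski (frameAd u (u (nullK m)) w) w = 0 := by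
  have : CompleteSpace E := FiniteDimensional.complete ℝ E
  obtain ⟨U, hU, h1U, X, hX, hXs, hflow⟩ := hK.exists_field 1
  obtain ⟨V, hV, h1V, hVU, ε, hε, φ, hφ, hpres⟩ := hflow 1 h1U
  have h0 : (0 : ℝ) ∈ Set.Ioo (-ε) ε := by simpa using hε
  have hεn : Set.Ioo (-ε) ε ∈ nhds (0 : ℝ) := isOpen_Ioo.mem_nhds h0
  have hVn : ∀ᶠ x in nhds (1 : N), x ∈ V := hV.mem_nhds h1V
  have hφs : ContMDiffAt (𝓘(ℝ, ℝ).prod 𝓘(ℝ, E)) 𝓘(ℝ, E) ∞ (fun p : ℝ × N => φ p.1 p.2) (0, 1) :=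
    hφ.smooth.contMDiffAt (prod_mem_nhds hεn hVn)
  have hder := hasDerivAt_mfderiv_translated_flow hφs (hVn.mono hφ.zero)
    (hVn.mono fun x hx => (hφ.integral x hx 0 h0).hasMFDerivAt hεn) (u w)
  obtain ⟨c, d, hc, hbr⟩ := mlieBracket_eq_of_eventually_eq_smul
    (X := X) (Y := mulInvariantVectorField (u (nullK m))) (Z := mulInvariantVectorField (u w))
    (hXs.contMDiffAt (hU.mem_nhds h1U))
    (contMDiff_infty_mulInvariantVectorField (u (nullK m))).contMDiffAt
    (x₀ := 1) (fun h => nullK_ne_zero (u.injective (((mulInvariantVectorField_one (E := E) (N := N)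
      (u (nullK m))).symm.trans h).trans (map_zero u).symm)))
    (Filter.mem_of_superset (hU.mem_nhds h1U) fun x hx =>
      (hP.mem_nullLine_iff hu (X x)).1 (hX x hx).1)
  have hc0 : c ≠ 0 := by
    rintro rfl
    exact (hX 1 h1U).2 (by rw [hc, zero_smul])
  let T : ℝ → E → E := fun t z => mfderiv 𝓘(ℝ, E) 𝓘(ℝ, E) (fun y => (φ t 1)⁻¹ * φ t y) 1 z
  let v : E →L[ℝ] (Fin (m + 2) → ℝ) := LinearMap.toContinuousLinearMap (E := E) u.symm.toLinearMap
  -- The translated flow fixes the identity and preserves `P` there, so it sends `u` to another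
  -- frame at the identity, which differs from `u` by an element of `GN`.
  have hTg : ∀ t ∈ Set.Ioo (-ε) ε, ∃ g ∈ groupGN m, ∀ z, v (T t (u z)) = g z := fun t ht => by
    have hd : MDifferentiableAt 𝓘(ℝ, E) 𝓘(ℝ, E) (φ t) 1 :=
      (ContMDiffAt.comp (1 : N) (f := fun x : N => ((t, x) : ℝ × N))
        (hφ.smooth.contMDiffAt (prod_mem_nhds (isOpen_Ioo.mem_nhds ht) hVn))
        (contMDiffAt_const.prodMk contMDiffAt_id)).mdifferentiableAt (by simp)
    have hp : P.PreservedAt (fun y => (φ t 1)⁻¹ * φ t y) 1 :=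
      (hP (φ t 1)⁻¹ (φ t 1)).comp (hpres t ht 1 h1V).2 rfl
        (mdifferentiableAt_leftTranslation _ _) hd
    obtain ⟨g, hg, hg2⟩ := (P.mem_iff 1 _ hu _).1 ((P.mem_frames_congr (inv_mul_cancel (φ t 1))
      ((mfderiv 𝓘(ℝ, E) 𝓘(ℝ, E) (fun y => (φ t 1)⁻¹ * φ t y) 1 : E →L[ℝ] E).toLinearMap ∘ₗ
        u.toLinearMap)).1 (hp _ hu))
    exact ⟨g, hg, fun z => u.injective ((u.apply_symm_apply _).trans (LinearMap.congr_fun hg2 z))⟩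
  have hconst : (fun t => minkowski (v (T t (u w))) (v (T t (u w)))) =ᶠ[nhds 0]
      fun _ => minkowski w w := by
    filter_upwards [hεn] with t ht
    obtain ⟨g, hg, hg2⟩ := hTg t ht
    rw [hg2, hg.2.1 w w (by rwa [minkowski_nullK]) (by rwa [minkowski_nullK])]
  have hT0 : v (T 0 (u w)) = w := by
    refine (congrArg v (mfderiv_apply_of_eventuallyEq_id (E := E) ?_ (u w))).trans
      (u.symm_apply_apply w)
    filter_upwards [hVn] with y hy
    simp [hφ.zero y hy, hφ.zero 1 h1V]
  have hd2 := (v.hasFDerivAt.comp_hasDerivAt (0 : ℝ) hder).minkowski_self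
  have hd3 := hd2.unique ((hasDerivAt_const (0 : ℝ) _).congr_of_eventuallyEq hconst)
  have hv : v (VectorField.mlieBracket 𝓘(ℝ, E) (mulInvariantVectorField (I := 𝓘(ℝ, E)) (u w)) X 1)
      = -c • frameAd u (u (nullK m)) w + d • nullK m := by
    refine u.injective ((u.apply_symm_apply _).trans (hbr.trans ?_))
    rw [map_add, map_smul, map_smul, apply_frameAd, neg_smul, ← smul_neg, lie_skew]
    let b : GroupLieAlgebra 𝓘(ℝ, E) N := ⁅u w, u (nullK m)⁆
    exact congrArg (fun y : E => c • (show E from b) + d • y)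
      (mulInvariantVectorField_one (E := E) (N := N) (u (nullK m)))
  have h4 : 2 * minkowski (-c • frameAd u (u (nullK m)) w + d • nullK m) w = 0 := by
    have hd4 : 2 * minkowski (v (VectorField.mlieBracket 𝓘(ℝ, E)
      (mulInvariantVectorField (I := 𝓘(ℝ, E)) (u w)) X 1)) (v (T 0 (u w))) = 0 := hd3
    rwa [hT0, hv] at hd4
  -- The unknown term `d k` drops out because `k` is orthogonal to `w`, and `c ≠ 0` because the
  -- Kundt field does not vanish.
  rw [minkowski_add_left, minkowski_smul_left, minkowski_smul_left, minkowski_nullK, hw] at h4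
  simpa [hc0] using h4

/-- The flow of a left-invariant vector field, translated back to the identity. -/
theorem hasDerivAt_mfderiv_conj {A : E} {γ : ℝ → N} [T2Space N] (h0 : γ 0 = 1)
    (hγ : IsMIntegralCurve γ (mulInvariantVectorField (I := 𝓘(ℝ, E)) A)) (Z : E) (s : ℝ) :
    HasDerivAt (F := E)
      (fun t => mfderiv 𝓘(ℝ, E) 𝓘(ℝ, E) (fun y => (γ t)⁻¹ * (y * γ t)) 1 Z)
      ((mfderiv 𝓘(ℝ, E) 𝓘(ℝ, E) (fun y => (γ s)⁻¹ * (y * γ s)) 1 : E → E)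
        (-⁅(show GroupLieAlgebra 𝓘(ℝ, E) N from A), (show GroupLieAlgebra 𝓘(ℝ, E) N from Z)⁆)) s := by
  have : CompleteSpace E := FiniteDimensional.complete ℝ E
  have hγs := hγ.contMDiff_of_mulInvariantVectorField h0
  have h := hasDerivAt_mfderiv_translated_flow (φ := fun t y => y * γ t)
    (X := mulInvariantVectorField (I := 𝓘(ℝ, E)) A)
    ((contMDiff_snd.mul (hγs.comp contMDiff_fst)).contMDiffAt)
    (.of_forall fun x => by simp [h0])
    (.of_forall fun x => (hγ 0).mul_left_mulInvariantVectorField x) Z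
  let T : ℝ → E →L[ℝ] E := fun t => mfderiv 𝓘(ℝ, E) 𝓘(ℝ, E) (fun y => (γ t)⁻¹ * (y * γ t)) 1
  let b : GroupLieAlgebra 𝓘(ℝ, E) N :=
    ⁅(show GroupLieAlgebra 𝓘(ℝ, E) N from Z), (show GroupLieAlgebra 𝓘(ℝ, E) N from A)⁆
  have h' : HasDerivAt (fun t => T t Z) (show E from b) (s - s) := by
    rw [sub_self]
    exact h.congr_of_eventuallyEq (.of_forall fun t => congrArg
      (fun g : N => (mfderiv 𝓘(ℝ, E) 𝓘(ℝ, E) (fun y => g⁻¹ * (y * γ t)) 1 : E → E) Z)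
      (one_mul (γ t)).symm)
  have hconj : ∀ g x : N, MDifferentiableAt 𝓘(ℝ, E) 𝓘(ℝ, E) (fun y => g⁻¹ * (y * g)) x :=
    fun g x => (mdifferentiableAt_leftTranslation g⁻¹ (x * g)).comp (x : N)
      (mdifferentiableAt_rightTranslation g x)
  -- Conjugations by a one-parameter subgroup compose, which reduces the derivative at `s` to the
  -- one at `0`.
  have hadd : ∀ t, T t Z = T s (T (t - s) Z) :=
    fun t => mfderiv_apply_of_eq_comp (hconj _ _) (hconj _ _) (by simp) (funext fun y => by
      have := hγ.map_add_of_mulInvariantVectorField h0 (t - s) s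
      rw [sub_add_cancel] at this
      simp [this, mul_assoc]) Z
  have h2 : HasDerivAt (fun t => T s (T (t - s) Z)) (T s b) s :=
    (T s).hasFDerivAt.comp_hasDerivAt s (h'.comp_sub_const s s)
  refine (h2.congr_of_eventuallyEq (.of_forall hadd)).congr_deriv (congrArg (T s) ?_)
  exact (lie_skew (show GroupLieAlgebra 𝓘(ℝ, E) N from Z)
    (show GroupLieAlgebra 𝓘(ℝ, E) N from A)).symm

end LeftInvariantKundt

end

/-! ### The main theorem -/

theorem mainTheorem9 {m : ℕ} {N : Type*} [TopologicalSpace N] [T2Space N]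
    [ChartedSpace (EuclideanSpace ℝ (Fin (m + 2))) N] [Group N]
    [LieGroup (𝓘(ℝ, EuclideanSpace ℝ (Fin (m + 2)))) ∞ N]
    (hnil : LieRing.IsNilpotent (GroupLieAlgebra 𝓘(ℝ, EuclideanSpace ℝ (Fin (m + 2))) N))
    (P : GNStructure 𝓘(ℝ, EuclideanSpace ℝ (Fin (m + 2))) N m)
    (hinv : P.IsLeftInvariant) (hKundt : P.IsKundt)
    (Q : NullQuadruple (GroupLieAlgebra 𝓘(ℝ, EuclideanSpace ℝ (Fin (m + 2))) N))
    (hQ : Q.CorrespondsTo P) :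
    (∀ A ∈ Q.a, ∀ B ∈ Q.b, ⁅A, B⁆ ∈ Q.a) ∧
    (∀ A ∈ Q.a, ∀ Z : GroupLieAlgebra 𝓘(ℝ, EuclideanSpace ℝ (Fin (m + 2))) N, ⁅A, Z⁆ ∈ Q.b) ∧
    ∀ A ∈ Q.a, P.IsInfinitesimalAutomorphism (fun x => mulInvariantVectorField A x) := by
  obtain ⟨u₀, hu₀⟩ := P.nonempty 1
  let u : (Fin (m + 2) → ℝ) ≃ₗ[ℝ] GroupLieAlgebra 𝓘(ℝ, EuclideanSpace ℝ (Fin (m + 2))) N :=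
    LinearEquiv.ofBijective u₀ (P.bijective 1 u₀ hu₀)
  have hu : u.toLinearMap ∈ P.frames 1 := hu₀
  let D := frameAd u (u (nullK m))
  have hnilD : IsNilpotent D := isNilpotent_frameAd u _
  have hDk : D (nullK m) = 0 := u.injective (by rw [apply_frameAd, lie_self, map_zero])
  have hb : ∀ w : Fin (m + 2) → ℝ, w 1 = 0 → u w ∈ P.nullHyperplane 1 := fun w hw =>
    (P.mem_nullHyperplane_iff hu _).2 ⟨w, hw, rfl⟩
  have hDperp : ∀ w, w 1 = 0 → D w 1 = 0 := fun w hw => by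
    obtain ⟨w', hw', h⟩ := (P.mem_nullHyperplane_iff hu _).1 (hinv.lie_mem_nullHyperplane
      hKundt.integrable (hb _ nullK_one) (hb w hw))
    have hw2 : w' = D w := u.injective (h.trans (apply_frameAd u _ w).symm)
    rwa [← hw2]
  have hDline : ∀ w, w 1 = 0 → ∃ c : ℝ, D w = c • nullK m := fun w hw =>
    exists_eq_smul_nullK_of_isNilpotent hnilD hDperp
      (fun w hw => P.minkowski_frameAd_eq_zero hinv hKundt u hu hw) hw
  have hDone : ∀ z, D z 1 = 0 := apply_one_eq_zero_of_isNilpotent hnilD hDperp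
  have hlie : ∀ (c : ℝ) w, ⁅c • u (nullK m), u w⁆ = u (c • D w) := fun c w => by
    rw [map_smul, apply_frameAd, smul_lie]
  refine ⟨fun A hA B hB => ?_, fun A hA Z => ?_, fun A hA => ?_⟩
  · rw [hQ.a_eq] at hA ⊢
    rw [hQ.b_eq] at hB
    obtain ⟨c, rfl⟩ := (P.mem_nullLine_iff hu A).1 hA
    obtain ⟨w, hw, rfl⟩ := (P.mem_nullHyperplane_iff hu B).1 hB
    obtain ⟨c', hc'⟩ := hDline w hw
    refine (P.mem_nullLine_iff hu _).2 ⟨c * c', (hlie c w).trans ?_⟩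
    rw [hc', smul_smul, map_smul]
    rfl
  · rw [hQ.a_eq] at hA
    rw [hQ.b_eq]
    obtain ⟨c, rfl⟩ := (P.mem_nullLine_iff hu A).1 hA
    obtain ⟨z, rfl⟩ := u.surjective Z
    exact (hlie c z) ▸ hb _ (by simp [hDone])
  · rw [hQ.a_eq] at hA
    obtain ⟨c, rfl⟩ := (P.mem_nullLine_iff hu A).1 hA
    obtain ⟨γ, hγ0, hγ⟩ := exists_isMIntegralCurve_mulInvariantVectorField
      (E := EuclideanSpace ℝ (Fin (m + 2))) (N := N) (c • u (nullK m))
    have hγs := hγ.contMDiff_of_mulInvariantVectorField hγ0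
    refine ⟨(contMDiff_infty_mulInvariantVectorField _).contMDiffOn, fun t =>
      { toEquiv := Equiv.mulRight (γ t)
        contMDiff_toFun := contMDiff_mul_right
        contMDiff_invFun := contMDiff_mul_right }, ⟨?_, fun x _ => ?_, fun x _ t _ => ?_⟩, fun t x =>
      hinv.preservedAt ?_ x⟩
    · exact (contMDiff_snd.mul (hγs.comp contMDiff_fst)).contMDiffOn
    · change x * γ 0 = x
      rw [hγ0, mul_one]
    · exact ((hγ t).mul_left_mulInvariantVectorField x).hasMFDerivWithinAt
    · let T : ℝ → EuclideanSpace ℝ (Fin (m + 2)) →L[ℝ] EuclideanSpace ℝ (Fin (m + 2)) := fun t =>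
        mfderiv 𝓘(ℝ, EuclideanSpace ℝ (Fin (m + 2))) 𝓘(ℝ, EuclideanSpace ℝ (Fin (m + 2)))
          (fun y : N => (γ t)⁻¹ * (y * γ t)) 1
      let v : EuclideanSpace ℝ (Fin (m + 2)) →L[ℝ] (Fin (m + 2) → ℝ) :=
        LinearMap.toContinuousLinearMap (E := EuclideanSpace ℝ (Fin (m + 2))) u.symm.toLinearMap
      have huv : ∀ z, u (v z) = z := u.apply_symm_apply
      have hS0 : ∀ w, v (T 0 (u w)) = w := fun w => by
        refine (congrArg v (mfderiv_apply_of_eventuallyEq_id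
          (E := EuclideanSpace ℝ (Fin (m + 2))) (.of_forall fun y => ?_) (u w))).trans
          (u.symm_apply_apply w)
        simp [hγ0]
      -- The generator is `-c • D`, since the conjugation by `γ` differentiates to `[·, A]` with `A
      -- = c u(k)`.
      have hS : ∀ w s, HasDerivAt (fun t => v (T t (u w))) (v (T s (u ((-c • D) w)))) s :=
        fun w s => by
          refine (v.hasFDerivAt.comp_hasDerivAt s
            (hasDerivAt_mfderiv_conj hγ0 hγ (u w) s)).congr_deriv
            (congrArg (fun z => v (T s z)) ((congrArg Neg.neg (hlie c w)).trans ?_))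
          rw [← map_neg, ← neg_smul]
          rfl
      have hline : ∀ w, w 1 = 0 → ∃ c' : ℝ, (-c • D) w = c' • nullK m := fun w hw => by
        obtain ⟨c', hc'⟩ := hDline w hw
        exact ⟨-c * c', by rw [LinearMap.smul_apply, hc', smul_smul]⟩
      obtain ⟨g, hg, hSg⟩ := exists_mem_groupGN_of_hasDerivAt (D := -c • D)
        (S := fun t => v.toLinearMap ∘ₗ (T t).toLinearMap ∘ₗ u.toLinearMap)
        hS0 hS (by simp [hDk]) hline (fun z => by simp [hDone]) t
      intro u' hu'
      -- Any other frame at the identity is `u ∘ h` with `h ∈ GN`, and `T t ∘ u ∘ h = u ∘ (g h)`.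
      obtain ⟨h, hh, rfl⟩ := (P.mem_iff 1 _ hu u').1 hu'
      refine (P.mem_frames_congr (by simp)
        ((T t).toLinearMap ∘ₗ u.toLinearMap ∘ₗ h.toLinearMap)).2
        ((P.mem_iff 1 _ hu _).2 ⟨g * h, mul_mem hg hh, LinearMap.ext fun w => ?_⟩)
      exact (huv _).symm.trans (congrArg u (LinearMap.congr_fun hSg (h w)))
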